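/- Let $N\ge 3$. A *source* is a set $S=\overline U\subset\mathbb R^N$, where $U$ is a nonempty bounded open set with $C^2$ boundary. For $A,B\subset\mathbb R^N$ write $A\subset\subset B$ if $\overline A$ is compact and contained in the interior of $B$. For $K\subset\mathbb R^N$ let $d_K(x)=\inf_{y\in K}|x-y|$, and let $d^s_K(x)=d_K(x)$ if $x\notin K$ and $d^s_K(x)=-d_{\partial K}(x)$ if $x\in K$. Let $E(S)$ be the set of compactly supported $u\in H^1(\mathbb R^N)\cap L^\infty(\mathbb R^N)$ with $u=1$ a.e. on $S$. For $h>0$ and a bounded open set $\Omega$ with $S\subset\subset\Omega$, define for $u\in E(S)$ $$J_h(\Omega,u)=\int_{\mathbb R^N\setminus S}\Big(|\nabla u|^2+\mathbf 1_{\{u>0\}}\big(1+\tfrac1h d^s_\Omega\big)_+\Big)\,dx ,\qquad \hat\Omega_h=\{y\in\Omega : d_{\partial\Omega}(y)>h\}.$$ In the conclusion below, $\{u>0\}$ is understood for the precise representative of $u$: it is the set of points $y$ at which $\lim_{\delta\to0^+}|B(y,\delta)|^{-1}\int_{B(y,\delta)}u$ exists and is positive (when $u$ is continuous this is the usual set $\{u>0\}$).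 **Lemma.** Let $R>0$ and $r_0\in\big(0,R/2^{1/(N-2)}\big)$, and let $M$ be a real number such that $\sqrt{1+M}\ge 4(N-2)/r_0$. Then there is $h_0=h_0(N,r_0,R,M)>0$ such that, for every $h\in(0,h_0)$, every $r\in\big(r_0,R/2^{1/(N-2)}\big)$, every source $S$, every bounded open set $\Omega$ with $S\subset\subset\Omega$, every $x\notin\overline\Omega$ with $d_\Omega(x)\ge r$ and $d_S(x)\ge R$, and every minimizer $u$ of $J_h(\Omega,\cdot)$ over $E(S)$, $$d_{\{u>0\}\cup\hat\Omega_h}(x)\ \ge\ r-Mh .$$ -/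

import Mathlib

open MeasureTheory Set Filter Topology
open scoped ContDiff

noncomputable section

namespace BernoulliFlow

/-- The Euclidean space `ℝ^N`. -/
abbrev Euc (N : ℕ) := EuclideanSpace ℝ (Fin N)

variable {N : ℕ}

/-- `A ⊂⊂ B`: the closure of `A` is compact and contained in the interior of `B`. -/
def CompactlyContained (A B : Set (Euc N)) : Prop :=
  IsCompact (closure A) ∧ closure A ⊆ interior B

/-- The class `𝒟` of sets `K ⊂⊂ ℝ^N` with `S ⊂⊂ K`. -/
def classD (S : Set (Euc N)) : Set (Set (Euc N)) :=
  {K | CompactlyContained K univ ∧ CompactlyContained S K}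

/-- The open set `U` has a `C²` boundary: near each of its boundary points it is the strict
sublevel set `{φ < 0}` of a `C²` function with nonvanishing differential there. -/
def HasC2Boundary (U : Set (Euc N)) : Prop :=
  ∀ x ∈ frontier U, ∃ (V : Set (Euc N)) (φ : Euc N → ℝ),
    IsOpen V ∧ x ∈ V ∧ ContDiffOn ℝ 2 φ V ∧ fderiv ℝ φ x ≠ 0 ∧
      U ∩ V = {y | φ y < 0} ∩ V

/-- A source: the closure of a nonempty bounded open set with `C²` boundary. -/
def IsSource (S : Set (Euc N)) : Prop :=
  ∃ U : Set (Euc N), IsOpen U ∧ U.Nonempty ∧ Bornology.IsBounded U ∧ HasC2Boundary U ∧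
    S = closure U

open Classical in
/-- The signed distance to `K`: the distance to `K` outside `K`, minus the distance to `∂K`
inside `K`. -/
def sdist (K : Set (Euc N)) (x : Euc N) : ℝ :=
  if x ∈ K then -Metric.infDist x (frontier K) else Metric.infDist x K

/-- `G` is a weak gradient of `u` on `ℝ^N`. -/
def IsWeakGradient (u : Euc N → ℝ) (G : Euc N → Euc N) : Prop :=
  LocallyIntegrable u volume ∧ LocallyIntegrable G volume ∧
    ∀ φ : Euc N → ℝ, ContDiff ℝ ∞ φ → HasCompactSupport φ → ∀ e : Euc N,
      ∫ x, u x * fderiv ℝ φ x e = -∫ x, φ x * inner ℝ (G x) e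

open Classical in
/-- The weak gradient of `u` (unique up to a null set), and `0` if there is none. -/
def weakGrad (u : Euc N → ℝ) : Euc N → Euc N :=
  if h : ∃ G, IsWeakGradient u G then h.choose else 0

/-- `u ∈ H¹(ℝ^N)`. -/
def MemH1 (u : Euc N → ℝ) : Prop :=
  MemLp u 2 volume ∧ ∃ G, IsWeakGradient u G ∧ MemLp G 2 volume

/-- The space `E(S)` of compactly supported functions in `H¹(ℝ^N) ∩ L^∞(ℝ^N)` which are equal
to `1` on `S`. All conditions are up to null sets. -/
def admissible (S : Set (Euc N)) : Set (Euc N → ℝ) :=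
  {u | MemH1 u ∧ MemLp u ⊤ volume ∧ (∀ᵐ x ∂volume, x ∈ S → u x = 1) ∧
    ∃ K : Set (Euc N), IsCompact K ∧ ∀ᵐ x ∂volume, x ∉ K → u x = 0}

/-- The functional `J_h^S(Ω, u) = ∫_{ℝ^N ∖ S} |∇u|² + 1_{u > 0} (1 + d^s_Ω / h)_+`. -/
def J (S : Set (Euc N)) (h : ℝ) (Ω : Set (Euc N)) (u : Euc N → ℝ) : ℝ :=
  ∫ x in Sᶜ, (‖weakGrad u x‖ ^ 2 +
    indicator {y | 0 < u y} (fun y => max (1 + 1 / h * sdist Ω y) 0) x)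

/-- `u` is a minimizer of `J_h^S(Ω, ·)` over `E(S)`. -/
def IsMinimizer (S : Set (Euc N)) (h : ℝ) (Ω : Set (Euc N)) (u : Euc N → ℝ) : Prop :=
  u ∈ admissible S ∧ IsMinOn (J S h Ω) (admissible S) u

/-- The set `{u > 0}` for a function `u` defined up to null sets, read pointwise through the
precise representative `u*(y) = lim_{δ → 0} ⨍_{B(y, δ)} u`: the set of points `y` where this
limit exists and is positive. It depends only on the a.e. class of `u`, and it is the pointwise
set `{u > 0}` when `u` is continuous, as shown below. -/
def posSet (u : Euc N → ℝ) : Set (Euc N) :=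
  {y | ∃ c : ℝ, 0 < c ∧
    Tendsto (fun δ : ℝ => ⨍ z in Metric.closedBall y δ, u z) (𝓝[>] 0) (𝓝 c)}

/-- The inner set `Ω̂_h = {y ∈ Ω : d_{∂Ω}(y) > h}`. -/
def innerSet (Ω : Set (Euc N)) (h : ℝ) : Set (Euc N) :=
  {y | y ∈ Ω ∧ h < Metric.infDist y (frontier Ω)}

theorem posSet_congr {u v : Euc N → ℝ} (huv : u =ᵐ[volume] v) : posSet u = posSet v := by
  have key : ∀ y : Euc N, ∀ δ : ℝ,
      ⨍ z in Metric.closedBall y δ, u z = ⨍ z in Metric.closedBall y δ, v z := fun y δ =>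
    average_congr (ae_restrict_of_ae huv)
  ext y
  simp only [posSet, key]

theorem posSet_of_continuous {u : Euc N → ℝ} (hu : Continuous u) :
    posSet u = {y | 0 < u y} := by
  have key : ∀ y : Euc N,
      Tendsto (fun δ : ℝ => ⨍ z in Metric.closedBall y δ, u z) (𝓝[>] 0) (𝓝 (u y)) := by
    intro y
    rw [Metric.tendsto_nhds]
    intro ε hε
    obtain ⟨η, hη, hball⟩ := Metric.continuous_iff.1 hu y (ε / 2) (half_pos hε)
    filter_upwards [Ioo_mem_nhdsGT hη] with δ hδ
    have hmem : (⨍ z in Metric.closedBall y δ, u z) ∈ Metric.closedBall (u y) (ε / 2) := by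
      refine (convex_closedBall (u y) (ε / 2)).set_average_mem Metric.isClosed_closedBall
        (Metric.measure_closedBall_pos volume y hδ.1).ne' measure_closedBall_lt_top.ne ?_
        (hu.continuousOn.integrableOn_compact (isCompact_closedBall y δ))
      refine (ae_restrict_iff' Metric.isClosed_closedBall.measurableSet).2 (ae_of_all _ ?_)
      intro z hz
      exact (hball z (lt_of_le_of_lt hz hδ.2)).le
    exact lt_of_le_of_lt hmem (half_lt_self hε)
  ext y
  constructor
  · rintro ⟨c, hc, hlim⟩
    have : c = u y := tendsto_nhds_unique hlim (key y)
    rw [this] at hc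
    exact hc
  · intro hy
    exact ⟨u y, hy, key y⟩

end BernoulliFlow

end

/-! Write `N = n + 2` and `ρ = r - M h`. A point of `Ω` lies farther from `x` than from `∂Ω` by at
least `r`, so `d^s_Ω ≥ r - |y - x|` everywhere; on the ball `B_ρ(x)` this makes the weight `(1 +
d^s_Ω / h)_+` at least `1 + M`. Positivity there is expensive, and the claim is that a minimizer `u`
cannot afford it.

The competitor is `min(u, w)`, where `w` vanishes on `B_ρ`, is harmonic outside it and equals `1` on
`∂B_R`. It is admissible: `u ≤ 1` a.e. (truncation at `1` lowers the energy), while `w ≥ 1` outside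
`B_R`, and `S` does not meet the open ball `B_R`. Put `f = (u - w)_+`. Outside `B_ρ` the energy
changes by at most `-2 ∇f · ∇w`. Classically one integrates this by parts and meets a surface
integral of `u` over `∂B_ρ`, to be bounded by a trace inequality. Here the trace is avoided by
continuing `∇w` into `B_ρ` as the linear field `(b/ρ)(y - x)`, with `b` the slope of `w` at `∂B_ρ`:
the continued field is continuous, divergence free outside `B_ρ` and of divergence `N b/ρ` inside.
Since `u ≤ 1` and `2b|∇u| ≤ |∇u|² + b²`, the total change of energy is then at most `-ε |B_ρ ∩ {u >
0}|` with `ε = 1 + M - b² - 2N b/ρ`. If `ε > 0`, minimality forces `u ≤ 0` a.e. on `B_ρ`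
(`IsMinimizer.ae_nonpos_of_lt_weight`).

The hypothesis on `M` gives `ε > 0` at every radius in `[r₀, R/2^(1/n)]`, and compactness extends
this to radii within a uniform `δ` of that interval (`exists_barrierSlope_threshold`); `h₀` ensures
`|M h| < δ`. Points of the inner set are at distance more than `r + h` from `x`, by the same
geometry.

The analytic input is the chain rule for positive parts (`IsWeakGradient.posPart`) and the
divergence identity for the radial field (`IsWeakGradient.integral_radialPow_mul_inner`), both
proved by mollification. -/

noncomputable section

namespace BernoulliFlow

variable {N : ℕ}

/-! ### Mollification and convergence in `L¹` -/

open scoped Convolution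

/-- A sequence of bump functions shrinking to the origin. -/
def bump (N n : ℕ) : ContDiffBump (0 : Euc N) where
  rIn := 1 / (2 * ((n : ℝ) + 1))
  rOut := 1 / ((n : ℝ) + 1)
  rIn_pos := by positivity
  rIn_lt_rOut := by
    apply one_div_lt_one_div_of_lt <;> [positivity; skip]
    have : (0 : ℝ) ≤ n := n.cast_nonneg
    linarith

/-- The mollification of `g` at scale `1 / (n + 1)`. -/
def mollify (n : ℕ) (g : Euc N → ℝ) : Euc N → ℝ :=
  (bump N n).normed volume ⋆[ContinuousLinearMap.lsmul ℝ ℝ, volume] g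

theorem mollify_apply (n : ℕ) (g : Euc N → ℝ) (x : Euc N) :
    mollify n g x = ∫ t, (bump N n).normed volume (x - t) * g t := by
  simp [mollify, convolution_eq_swap]

theorem bump_rOut_le (N n : ℕ) : (bump N n).rOut ≤ 1 := by
  change 1 / ((n : ℝ) + 1) ≤ 1
  rw [div_le_one (by positivity)]
  simp

theorem tendsto_bump_rOut (N : ℕ) : Tendsto (fun n => (bump N n).rOut) atTop (𝓝 0) :=
  tendsto_one_div_add_atTop_nhds_zero_nat

theorem bump_normed_eq_zero {n : ℕ} {z : Euc N} (hz : 1 ≤ ‖z‖) :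
    (bump N n).normed volume z = 0 := by
  by_contra h
  have : z ∈ Function.support ((bump N n).normed volume) := h
  rw [ContDiffBump.support_normed_eq, Metric.mem_ball, dist_zero_right] at this
  linarith [bump_rOut_le N n]

theorem contDiff_mollify {g : Euc N → ℝ} (hg : LocallyIntegrable g volume) (n : ℕ) :
    ContDiff ℝ ∞ (mollify n g) :=
  (bump N n).hasCompactSupport_normed.contDiff_convolution_left _
    (bump N n).contDiff_normed hg

theorem ae_tendsto_mollify {g : Euc N → ℝ} (hg : LocallyIntegrable g volume) :
    ∀ᵐ x, Tendsto (fun n => mollify n g x) atTop (𝓝 (g x)) := by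
  refine ContDiffBump.ae_convolution_tendsto_right_of_locallyIntegrable (K := 2)
    (tendsto_bump_rOut N) (Eventually.of_forall fun n => ?_) hg
  -- The fixed ratio `2` of outer to inner radius is what the Lebesgue differentiation argument
  -- needs.
  change 1 / ((n : ℝ) + 1) ≤ 2 * (1 / (2 * ((n : ℝ) + 1)))
  apply le_of_eq
  field_simp

theorem integrable_mollify {g : Euc N → ℝ} (hg : Integrable g volume) (n : ℕ) :
    Integrable (mollify n g) volume :=
  ((bump N n).integrable_normed).integrable_convolution _ hg

/-- The kernel is nonnegative with mass one, so `|mollify n g| ≤ mollify n |g|` pointwise and the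
integral of the right side is that of `|g|`. -/
theorem integral_abs_mollify_le {g : Euc N → ℝ} (hg : Integrable g volume) (n : ℕ) :
    ∫ x, |mollify n g x| ≤ ∫ x, |g x| := by
  have h1 : ∫ x, mollify n (fun y => |g y|) x = ∫ x, |g x| := by
    unfold mollify
    rw [integral_convolution _ ((bump N n).integrable_normed) hg.abs,
      ContDiffBump.integral_normed]
    simp
  rw [← h1]
  refine integral_mono (integrable_mollify hg n).abs (integrable_mollify hg.abs n) fun x => ?_
  simp only [mollify_apply]
  refine (abs_integral_le_integral_abs).trans (le_of_eq ?_)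
  congr 1
  ext t
  rw [abs_mul, abs_of_nonneg ((bump N n).nonneg_normed _)]

theorem mollify_sub {g k : Euc N → ℝ} (hg : LocallyIntegrable g volume)
    (hk : LocallyIntegrable k volume) (n : ℕ) (x : Euc N) :
    mollify n (fun y => g y - k y) x = mollify n g x - mollify n k x := by
  have H : ∀ {f : Euc N → ℝ}, LocallyIntegrable f volume →
      Integrable (fun t => (bump N n).normed volume (x - t) * f t) volume := by
    intro f hf
    have := ((bump N n).hasCompactSupport_normed (μ := volume)).convolutionExists_left
      (ContinuousLinearMap.lsmul ℝ ℝ) (bump N n).continuous_normed hf x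
    simpa using this.integrable_swap
  simp only [mollify_apply, mul_sub]
  exact integral_sub (H hg) (H hk)

/-- Uniform continuity gives uniform convergence, and all supports stay in one ball of finite
volume. -/
theorem tendsto_integral_abs_mollify_sub_of_continuous {k : Euc N → ℝ} (hk : Continuous k)
    (hc : HasCompactSupport k) :
    Tendsto (fun n => ∫ x, |mollify n k x - k x|) atTop (𝓝 0) := by
  obtain ⟨r, hr⟩ := hc.isCompact.isBounded.subset_closedBall (0 : Euc N)
  have hsupp : ∀ n x, x ∉ Metric.closedBall (0 : Euc N) (r + 1) → mollify n k x - k x = 0 := by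
    intro n x hx
    rw [Metric.mem_closedBall, dist_zero_right, not_le] at hx
    have hk0 : ∀ y, r < ‖y‖ → k y = 0 := by
      intro y hy
      by_contra h
      have := hr (subset_tsupport _ h)
      rw [Metric.mem_closedBall, dist_zero_right] at this
      linarith
    rw [hk0 x (by linarith), mollify_apply, sub_zero]
    refine integral_eq_zero_of_ae (Eventually.of_forall fun t => ?_)
    rcases lt_or_ge r ‖t‖ with h | h
    · simp [hk0 t h]
    · have : 1 ≤ ‖x - t‖ := by
        have := norm_sub_norm_le x t
        linarith
      simp [bump_normed_eq_zero this]
  rw [Metric.tendsto_atTop]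
  intro ε hε
  set V := volume.real (Metric.closedBall (0 : Euc N) (r + 1)) with hV
  have hV0 : 0 ≤ V := measureReal_nonneg
  have hη : 0 < ε / (V + 1) := by positivity
  obtain ⟨δ, hδ, hδ'⟩ := Metric.uniformContinuous_iff.1
    (hc.uniformContinuous_of_continuous hk) (ε / (V + 1)) hη
  obtain ⟨n₀, hn₀⟩ := Metric.tendsto_atTop.1 (tendsto_bump_rOut N) δ hδ
  refine ⟨n₀, fun n hn => ?_⟩
  have hr' : (bump N n).rOut < δ := by
    have := hn₀ n hn
    rw [dist_zero_right, Real.norm_eq_abs] at this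
    exact (le_abs_self _).trans_lt this
  have hb : ∀ x, |mollify n k x - k x| ≤ ε / (V + 1) := by
    intro x
    have := ContDiffBump.dist_normed_convolution_le (φ := bump N n) (μ := volume) (x₀ := x)
      (ε := ε / (V + 1)) hk.aestronglyMeasurable
      (fun y hy => (hδ' ((Metric.mem_ball.1 hy).trans hr')).le)
    rwa [Real.dist_eq] at this
  have h1 : ∫ x, |mollify n k x - k x| =
      ∫ x in Metric.closedBall (0 : Euc N) (r + 1), |mollify n k x - k x| := by
    rw [setIntegral_eq_integral_of_forall_compl_eq_zero]
    intro x hx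
    rw [hsupp n x hx, abs_zero]
  have h2 : ‖∫ x in Metric.closedBall (0 : Euc N) (r + 1), |mollify n k x - k x|‖
      ≤ ε / (V + 1) * V := by
    refine norm_setIntegral_le_of_norm_le_const measure_closedBall_lt_top fun x _ => ?_
    rw [Real.norm_eq_abs, abs_abs]
    exact hb x
  rw [dist_zero_right, h1]
  refine h2.trans_lt ?_
  rw [div_mul_eq_mul_div, div_lt_iff₀ (by positivity)]
  nlinarith

/-- Density of continuous compactly supported functions, combined with the `L¹` contraction property
of mollification. -/
theorem tendsto_integral_abs_mollify_sub {g : Euc N → ℝ} (hg : Integrable g volume) :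
    Tendsto (fun n => ∫ x, |mollify n g x - g x|) atTop (𝓝 0) := by
  rw [Metric.tendsto_atTop]
  intro ε hε
  obtain ⟨k, hkc, hgk, hk, hki⟩ :=
    hg.exists_hasCompactSupport_integral_sub_le (ε := ε / 4) (by positivity)
  obtain ⟨n₀, hn₀⟩ := Metric.tendsto_atTop.1
    (tendsto_integral_abs_mollify_sub_of_continuous hk hkc) (ε / 4) (by positivity)
  refine ⟨n₀, fun n hn => ?_⟩
  have h1 := hn₀ n hn
  rw [dist_zero_right, Real.norm_eq_abs,
    abs_of_nonneg (integral_nonneg fun x => abs_nonneg _)] at h1 ⊢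
  have i1 := (integrable_mollify (hg.sub hki) n).abs
  have i2 := ((integrable_mollify hki n).sub hki).abs
  have i3 := (hg.sub hki).abs
  have hle : ∫ x, |mollify n g x - g x| ≤ ∫ x, (|mollify n (g - k) x|
      + |(mollify n k - k) x| + |(g - k) x|) := by
    refine integral_mono ((integrable_mollify hg n).sub hg).abs ((i1.add i2).add i3) fun x => ?_
    have e : mollify n g x - g x = mollify n (g - k) x + (mollify n k - k) x - (g - k) x := by
      have := mollify_sub hg.locallyIntegrable hki.locallyIntegrable n x
      change mollify n (g - k) x = _ at this
      rw [this]
      simp only [Pi.sub_apply]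
      ring
    change |mollify n g x - g x| ≤ _
    rw [e]
    exact (abs_sub _ _).trans (add_le_add_left (abs_add_le _ _) _)
  have hsum : ∫ x, (|mollify n (g - k) x| + |(mollify n k - k) x| + |(g - k) x|) =
      (∫ x, |mollify n (g - k) x|) + (∫ x, |(mollify n k - k) x|) + ∫ x, |(g - k) x| :=
    (integral_add (i1.add i2) i3).trans (congrArg (· + _) (integral_add i1 i2))
  rw [hsum] at hle
  have h2 := integral_abs_mollify_le (hg.sub hki) n
  have h3 : ∫ x, |(g - k) x| ≤ ε / 4 := hgk
  have h4 : ∫ x, |(mollify n k - k) x| < ε / 4 := h1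
  linarith

/-- The scale is at most `1`, so on `K` the mollification only sees `g` on the `1`-thickening of
`K`, and `g` may be cut off there. -/
theorem tendsto_setIntegral_abs_mollify_sub {g : Euc N → ℝ} (hg : LocallyIntegrable g volume)
    {K : Set (Euc N)} (hK : IsCompact K) :
    Tendsto (fun n => ∫ x in K, |mollify n g x - g x|) atTop (𝓝 0) := by
  set K' := Metric.cthickening 1 K with hK'
  have hK'c : IsCompact K' := hK.cthickening
  have hKK' : K ⊆ K' := Metric.self_subset_cthickening K
  have hi : Integrable (K'.indicator g) volume :=
    (integrable_indicator_iff hK'c.measurableSet).2 (hg.integrableOn_isCompact hK'c)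
  refine squeeze_zero (fun n => integral_nonneg fun x => abs_nonneg _) (fun n => ?_)
    (tendsto_integral_abs_mollify_sub hi)
  have : ∫ x in K, |mollify n g x - g x| =
      ∫ x in K, |mollify n (K'.indicator g) x - K'.indicator g x| := by
    refine setIntegral_congr_fun hK.measurableSet fun x hx => ?_
    have e1 : mollify n g x = mollify n (K'.indicator g) x := by
      simp only [mollify_apply]
      refine integral_congr_ae (Eventually.of_forall fun t => ?_)
      by_cases ht : t ∈ K'
      · simp [ht]
      · have : 1 ≤ ‖x - t‖ := by
          by_contra h
          push Not at h
          refine ht (Metric.mem_cthickening_of_dist_le t x 1 K hx ?_)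
          rw [dist_comm, dist_eq_norm]
          exact h.le
        simp [bump_normed_eq_zero this]
    simp only [e1, indicator_of_mem (hKK' hx)]
  rw [this]
  exact setIntegral_le_integral ((integrable_mollify hi n).sub hi).abs
    (Eventually.of_forall fun x => abs_nonneg _)

theorem mollify_eq_zero {g : Euc N → ℝ} {c : Euc N} {r : ℝ}
    (hg : ∀ᵐ y, y ∉ Metric.closedBall c r → g y = 0) (n : ℕ) {x : Euc N}
    (hx : x ∉ Metric.closedBall c (r + 1)) : mollify n g x = 0 := by
  rw [mollify_apply]
  refine integral_eq_zero_of_ae ?_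
  filter_upwards [hg] with t ht
  by_cases h : t ∈ Metric.closedBall c r
  · have : 1 ≤ ‖x - t‖ := by
      rw [Metric.mem_closedBall] at h hx
      have := dist_triangle x t c
      rw [← dist_eq_norm]
      linarith
    simp [bump_normed_eq_zero this]
  · simp [ht h]

/-- Differentiate the kernel, then test the weak gradient with `t ↦ φ (x - t)`; the sign from the
reflection cancels the one from integration by parts. -/
theorem fderiv_mollify {u : Euc N → ℝ} {G : Euc N → Euc N} (hu : IsWeakGradient u G) (n : ℕ)
    (x e : Euc N) :
    fderiv ℝ (mollify n u) x e = mollify n (fun y => inner ℝ (G y) e) x := by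
  set φ : Euc N → ℝ := (bump N n).normed volume with hφ
  have hφs : ContDiff ℝ ∞ φ := (bump N n).contDiff_normed
  have hφc : HasCompactSupport φ := (bump N n).hasCompactSupport_normed
  have hd := hφc.hasFDerivAt_convolution_left (ContinuousLinearMap.lsmul ℝ ℝ) (hφs.of_le (by simp))
    hu.1 x
  have h1 : fderiv ℝ (mollify n u) x e = ∫ t, u t * fderiv ℝ φ (x - t) e := by
    unfold mollify
    rw [hd.fderiv, convolution_eq_swap, ContinuousLinearMap.integral_apply]
    · refine integral_congr_ae (Eventually.of_forall fun t => ?_)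
      simp [mul_comm]
    · have := (hφc.fderiv ℝ).convolutionExists_left
        ((ContinuousLinearMap.lsmul ℝ ℝ).precompL (Euc N))
        (hφs.continuous_fderiv (by simp)) hu.1 x
      exact this.integrable_swap
  have hψs : ContDiff ℝ ∞ (fun t => φ (x - t)) := hφs.comp (contDiff_const.sub contDiff_id)
  have hψc : HasCompactSupport (fun t => φ (x - t)) :=
    hφc.comp_homeomorph (Homeomorph.subLeft x)
  have h2 := hu.2.2 _ hψs hψc e
  have h3 : ∀ t, fderiv ℝ (fun t => φ (x - t)) t e = - fderiv ℝ φ (x - t) e := by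
    intro t
    have a := (hφs.differentiable (by simp) (x - t)).hasFDerivAt
    have b : HasFDerivAt (fun t : Euc N => x - t) (-(ContinuousLinearMap.id ℝ (Euc N))) t :=
      (hasFDerivAt_id t).const_sub x
    have c : HasFDerivAt (fun t => φ (x - t)) _ t := a.comp t b
    rw [c.fderiv]
    simp
  simp only [h3, mul_neg, integral_neg] at h2
  rw [h1, mollify_apply]
  linarith

/-! ### Elementary calculus of weak gradients -/

theorem _root_.MeasureTheory.LocallyIntegrable.of_norm_le {F F' : Type*} [NormedAddCommGroup F]
    [NormedAddCommGroup F'] {f : Euc N → F} {g : Euc N → F'} (hf : LocallyIntegrable f volume)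
    (hg : AEStronglyMeasurable g volume) (h : ∀ x, ‖g x‖ ≤ ‖f x‖) :
    LocallyIntegrable g volume :=
  hf.mono hg (Eventually.of_forall h)

theorem _root_.MeasureTheory.LocallyIntegrable.inner_right {G : Euc N → Euc N}
    (hG : LocallyIntegrable G volume) (e : Euc N) :
    LocallyIntegrable (fun x => inner ℝ (G x) e) volume := by
  have h : LocallyIntegrable (fun x => ‖e‖ • G x) volume := hG.smul ‖e‖
  refine h.of_norm_le (hG.aestronglyMeasurable.inner aestronglyMeasurable_const) fun x => ?_
  rw [norm_smul, norm_norm, mul_comm]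
  exact norm_inner_le_norm _ _

theorem IsWeakGradient.integrable_mul_fderiv {u : Euc N → ℝ} (hu : LocallyIntegrable u volume)
    {φ : Euc N → ℝ} (hφ : ContDiff ℝ ∞ φ) (hc : HasCompactSupport φ) (e : Euc N) :
    Integrable (fun x => u x * fderiv ℝ φ x e) volume :=
  hu.integrable_smul_right_of_hasCompactSupport
    ((hφ.continuous_fderiv (by simp)).clm_apply continuous_const) (hc.fderiv_apply ℝ e)

theorem IsWeakGradient.integrable_mul_inner {G : Euc N → Euc N} (hG : LocallyIntegrable G volume)
    {φ : Euc N → ℝ} (hφ : Continuous φ) (hc : HasCompactSupport φ) (e : Euc N) :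
    Integrable (fun x => φ x * inner ℝ (G x) e) volume :=
  (hG.inner_right e).integrable_smul_left_of_hasCompactSupport hφ hc

/-- Makes the arbitrary choice in `weakGrad` harmless: any explicit weak gradient can replace it
under an integral. -/
theorem IsWeakGradient.ae_eq {u v : Euc N → ℝ} {G G' : Euc N → Euc N} (h : IsWeakGradient u G)
    (h' : IsWeakGradient v G') (huv : u =ᵐ[volume] v) : G =ᵐ[volume] G' := by
  refine ae_eq_of_integral_contDiff_smul_eq h.2.1 h'.2.1 fun φ hφ hc => ?_
  have i1 := h.2.1.integrable_smul_left_of_hasCompactSupport hφ.continuous hc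
  have i2 := h'.2.1.integrable_smul_left_of_hasCompactSupport hφ.continuous hc
  refine ext_inner_left ℝ fun e => ?_
  rw [← integral_inner i1, ← integral_inner i2]
  have e1 := h.2.2 φ hφ hc e
  have e2 := h'.2.2 φ hφ hc e
  have e3 : ∫ x, u x * fderiv ℝ φ x e = ∫ x, v x * fderiv ℝ φ x e :=
    integral_congr_ae (huv.mono fun x hx => by simp only [hx])
  simp only [real_inner_comm _ e, real_inner_smul_left]
  linarith

theorem IsWeakGradient.congr {u v : Euc N → ℝ} {G G' : Euc N → Euc N} (h : IsWeakGradient u G)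
    (huv : u =ᵐ[volume] v) (hG : G =ᵐ[volume] G') : IsWeakGradient v G' := by
  refine ⟨h.1.congr huv, h.2.1.congr hG, fun φ hφ hc e => ?_⟩
  have e3 : ∫ x, u x * fderiv ℝ φ x e = ∫ x, v x * fderiv ℝ φ x e :=
    integral_congr_ae (huv.mono fun x hx => by simp only [hx])
  have e4 : ∫ x, φ x * inner ℝ (G x) e = ∫ x, φ x * inner ℝ (G' x) e :=
    integral_congr_ae (hG.mono fun x hx => by simp only [hx])
  rw [← e3, ← e4]
  exact h.2.2 φ hφ hc e

theorem IsWeakGradient.sub {u v : Euc N → ℝ} {G G' : Euc N → Euc N} (h : IsWeakGradient u G)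
    (h' : IsWeakGradient v G') :
    IsWeakGradient (fun x => u x - v x) (fun x => G x - G' x) := by
  refine ⟨h.1.sub h'.1, h.2.1.sub h'.2.1, fun φ hφ hc e => ?_⟩
  simp only [sub_mul, inner_sub_left, mul_sub]
  rw [integral_sub (integrable_mul_fderiv h.1 hφ hc e) (integrable_mul_fderiv h'.1 hφ hc e),
    integral_sub (integrable_mul_inner h.2.1 hφ.continuous hc e)
      (integrable_mul_inner h'.2.1 hφ.continuous hc e), h.2.2 φ hφ hc e, h'.2.2 φ hφ hc e]
  ring

theorem MemH1.isWeakGradient {u : Euc N → ℝ} (hu : MemH1 u) : IsWeakGradient u (weakGrad u) := by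
  have h : ∃ G, IsWeakGradient u G := ⟨_, hu.2.choose_spec.1⟩
  unfold weakGrad
  rw [dif_pos h]
  exact h.choose_spec

theorem MemH1.memLp_weakGrad {u : Euc N → ℝ} (hu : MemH1 u) :
    MemLp (weakGrad u) 2 volume := by
  obtain ⟨G, hG, hG2⟩ := hu.2
  exact hG2.ae_eq (hG.ae_eq hu.isWeakGradient EventuallyEq.rfl)

/-! ### Chain rules -/

theorem tendsto_integral_of_abs_sub_le {F : ℕ → Euc N → ℝ} {F₀ : Euc N → ℝ}
    {H : ℕ → Euc N → ℝ} {K : Set (Euc N)} (hK : MeasurableSet K)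
    (hF : ∀ n, Integrable (F n) volume) (hF₀ : Integrable F₀ volume)
    (hH : ∀ n, IntegrableOn (H n) K volume)
    (hle : ∀ n x, |F n x - F₀ x| ≤ K.indicator (H n) x)
    (hlim : Tendsto (fun n => ∫ x in K, H n x) atTop (𝓝 0)) :
    Tendsto (fun n => ∫ x, F n x) atTop (𝓝 (∫ x, F₀ x)) := by
  rw [tendsto_iff_norm_sub_tendsto_zero]
  refine squeeze_zero (fun n => norm_nonneg _) (fun n => ?_) hlim
  rw [← integral_sub (hF n) hF₀, ← integral_indicator hK]
  refine (norm_integral_le_integral_norm _).trans ?_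
  exact integral_mono ((hF n).sub hF₀).norm ((integrable_indicator_iff hK).2 (hH n)) (hle n)

/-- The identity is classical for the mollifications of `u`; both sides pass to the limit because
`f` is `1`-Lipschitz and `f'` is bounded and continuous. -/
theorem IsWeakGradient.integral_comp_mul_fderiv {u : Euc N → ℝ} {G : Euc N → Euc N}
    (hu : IsWeakGradient u G) {f f' : ℝ → ℝ} (hf : ∀ s, HasDerivAt f (f' s) s)
    (hf'c : Continuous f') (hf' : ∀ s, |f' s| ≤ 1) {φ : Euc N → ℝ} (hφ : ContDiff ℝ ∞ φ)
    (hc : HasCompactSupport φ) (e : Euc N) :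
    ∫ x, f (u x) * fderiv ℝ φ x e = -∫ x, φ x * (f' (u x) * inner ℝ (G x) e) := by
  set g : Euc N → ℝ := fun x => inner ℝ (G x) e with hg
  have hgi : LocallyIntegrable g volume := hu.2.1.inner_right e
  have hfc : Continuous f := continuous_iff_continuousAt.2 fun s => (hf s).continuousAt
  have hflip : ∀ s t, |f s - f t| ≤ |s - t| := by
    intro s t
    have := Convex.norm_image_sub_le_of_norm_hasDerivWithin_le (f := f) (f' := f') (C := 1)
      (s := univ) (x := t) (y := s) (fun x _ => (hf x).hasDerivWithinAt) (fun x _ => hf' x)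
      convex_univ (mem_univ _) (mem_univ _)
    simpa using this
  set K := tsupport φ with hK
  have hKc : IsCompact K := hc
  set D : Euc N → ℝ := fun x => fderiv ℝ φ x e with hD
  have hDcont : Continuous D := (hφ.continuous_fderiv (by simp)).clm_apply continuous_const
  have hDc : HasCompactSupport D := hc.fderiv_apply ℝ e
  obtain ⟨C₁, hC₁⟩ := hDc.exists_bound_of_continuous hDcont
  obtain ⟨C₂, hC₂⟩ := hc.exists_bound_of_continuous hφ.continuous
  have hDK : ∀ x, x ∉ K → D x = 0 := by
    intro x hx
    have : fderiv ℝ φ x = 0 := by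
      by_contra h
      exact hx (support_fderiv_subset ℝ h)
    simp [hD, this]
  have hφK : ∀ x, x ∉ K → φ x = 0 := fun x hx => image_eq_zero_of_notMem_tsupport hx
  have hmu : ∀ n, Continuous (mollify n u) := fun n => (contDiff_mollify hu.1 n).continuous
  have hmg : ∀ n, Continuous (mollify n g) := fun n => (contDiff_mollify hgi n).continuous
  have hsm : ∀ n, ∫ x, f (mollify n u x) * D x =
      -∫ x, φ x * (f' (mollify n u x) * mollify n g x) := by
    intro n
    have hder : ∀ x, HasFDerivAt (fun x => f (mollify n u x))
        (f' (mollify n u x) • fderiv ℝ (mollify n u) x) x := fun x =>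
      (hf _).comp_hasFDerivAt x
        (((contDiff_mollify hu.1 n).differentiable (by simp)) x).hasFDerivAt
    have e1 : ∀ x, fderiv ℝ (fun x => f (mollify n u x)) x e =
        f' (mollify n u x) * mollify n g x := by
      intro x
      rw [(hder x).fderiv, _root_.smul_apply, fderiv_mollify hu, smul_eq_mul]
    rw [integral_mul_fderiv_eq_neg_fderiv_mul_of_integrable]
    · simp only [e1]
      congr 2
      ext x
      ring
    · simp only [e1]
      exact (((hf'c.comp (hmu n)).mul (hmg n)).mul hφ.continuous).integrable_of_hasCompactSupport
        hc.mul_left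
    · exact ((hfc.comp (hmu n)).mul hDcont).integrable_of_hasCompactSupport hDc.mul_left
    · exact ((hfc.comp (hmu n)).mul hφ.continuous).integrable_of_hasCompactSupport hc.mul_left
    · exact fun x _ => (hder x).differentiableAt
    · exact fun x _ => hφ.differentiable (by simp) x
  have hfu : LocallyIntegrable (fun x => f (u x)) volume := by
    have h1 : LocallyIntegrable (fun x => |u x| + |f 0|) volume :=
      (hu.1.of_norm_le hu.1.aestronglyMeasurable.norm fun x => (norm_norm _).le).add
        (locallyIntegrable_const _)
    refine h1.of_norm_le (hfc.comp_aestronglyMeasurable hu.1.aestronglyMeasurable) fun x => ?_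
    rw [Real.norm_eq_abs, Real.norm_eq_abs, abs_of_nonneg (by positivity : 0 ≤ |u x| + |f 0|)]
    have := hflip (u x) 0
    rw [sub_zero] at this
    have h2 := abs_add_le (f (u x) - f 0) (f 0)
    rw [sub_add_cancel] at h2
    linarith
  have hgu : LocallyIntegrable (fun x => f' (u x) * g x) volume := by
    refine hgi.of_norm_le ((hf'c.comp_aestronglyMeasurable hu.1.aestronglyMeasurable).mul
      hgi.aestronglyMeasurable) fun x => ?_
    rw [norm_mul]
    exact mul_le_of_le_one_left (norm_nonneg _) (hf' _)
  have hL : Tendsto (fun n => ∫ x, f (mollify n u x) * D x) atTop (𝓝 (∫ x, f (u x) * D x)) := by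
    refine tendsto_integral_of_abs_sub_le (H := fun n x => C₁ * |mollify n u x - u x|) (K := K)
      hKc.measurableSet
      (fun n => ((hfc.comp (hmu n)).mul hDcont).integrable_of_hasCompactSupport hDc.mul_left)
      (hfu.integrable_smul_right_of_hasCompactSupport hDcont hDc) (fun n => ?_) (fun n x => ?_) ?_
    · exact ((((hmu n).locallyIntegrable.sub hu.1).integrableOn_isCompact hKc).abs).const_mul _
    · by_cases hx : x ∈ K
      · rw [indicator_of_mem hx, ← sub_mul, abs_mul, mul_comm]
        exact mul_le_mul (hC₁ x) (hflip _ _) (abs_nonneg _) ((norm_nonneg _).trans (hC₁ x))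
      · simp [hx, hDK x hx]
    · have := (tendsto_setIntegral_abs_mollify_sub hu.1 hKc).const_mul C₁
      simpa only [integral_const_mul, mul_zero] using this
  have hR : Tendsto (fun n => ∫ x, φ x * (f' (mollify n u x) * mollify n g x)) atTop
      (𝓝 (∫ x, φ x * (f' (u x) * g x))) := by
    have hi1 : ∀ n, IntegrableOn (fun x => |mollify n g x - g x|) K volume := fun n =>
      (((hmg n).locallyIntegrable.sub hgi).integrableOn_isCompact hKc).abs
    have hm2 : ∀ n, AEStronglyMeasurable
        (fun x => |f' (mollify n u x) - f' (u x)| * |g x|) volume := fun n =>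
      (((hf'c.comp (hmu n)).aestronglyMeasurable.sub
        (hf'c.comp_aestronglyMeasurable hu.1.aestronglyMeasurable)).norm).mul
        hgi.aestronglyMeasurable.norm
    have hb2 : ∀ n x, ‖|f' (mollify n u x) - f' (u x)| * |g x|‖ ≤ 2 * |g x| := by
      intro n x
      rw [norm_mul, Real.norm_eq_abs, Real.norm_eq_abs, abs_abs, abs_abs]
      refine mul_le_mul_of_nonneg_right ?_ (abs_nonneg _)
      have := abs_sub (f' (mollify n u x)) (f' (u x))
      linarith [hf' (mollify n u x), hf' (u x)]
    have hg2 : IntegrableOn (fun x => 2 * |g x|) K volume :=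
      ((hgi.integrableOn_isCompact hKc).abs).const_mul 2
    have hi2 : ∀ n, IntegrableOn (fun x => |f' (mollify n u x) - f' (u x)| * |g x|) K volume :=
      fun n => Integrable.mono' hg2 (hm2 n).restrict (Eventually.of_forall (hb2 n))
    refine tendsto_integral_of_abs_sub_le (K := K) (H := fun n x => C₂ * (|mollify n g x - g x| +
        |f' (mollify n u x) - f' (u x)| * |g x|)) hKc.measurableSet
      (fun n => (hφ.continuous.mul
        ((hf'c.comp (hmu n)).mul (hmg n))).integrable_of_hasCompactSupport hc.mul_right)
      (hgu.integrable_smul_left_of_hasCompactSupport hφ.continuous hc)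
      (fun n => ((hi1 n).add (hi2 n)).const_mul _) (fun n x => ?_) ?_
    · by_cases hx : x ∈ K
      · rw [indicator_of_mem hx, ← mul_sub, abs_mul]
        refine mul_le_mul (hC₂ x) ?_ (abs_nonneg _) ((norm_nonneg _).trans (hC₂ x))
        -- The first term tends to zero by `L¹` convergence on `K`, the second by dominated
        -- convergence, since the mollifications of `u` converge a.e.
        have e : f' (mollify n u x) * mollify n g x - f' (u x) * g x =
            f' (mollify n u x) * (mollify n g x - g x) +
              (f' (mollify n u x) - f' (u x)) * g x := by ring
        rw [e]
        refine (abs_add_le _ _).trans ?_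
        rw [abs_mul, abs_mul]
        exact add_le_add_left (mul_le_of_le_one_left (abs_nonneg _) (hf' _)) _
      · simp [hx, hφK x hx]
    · have l1 := tendsto_setIntegral_abs_mollify_sub hgi hKc
      have l2 : Tendsto (fun n => ∫ x in K, |f' (mollify n u x) - f' (u x)| * |g x|) atTop
          (𝓝 (∫ x in K, (0 : ℝ))) := by
        refine tendsto_integral_of_dominated_convergence _ (fun n => (hm2 n).restrict) hg2
          (fun n => Eventually.of_forall (hb2 n)) ?_
        refine ae_restrict_of_ae ?_
        filter_upwards [ae_tendsto_mollify hu.1] with x hx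
        have h1 : Tendsto (fun n => f' (mollify n u x)) atTop (𝓝 (f' (u x))) :=
          (hf'c.tendsto _).comp hx
        have h2 := ((h1.sub_const (f' (u x))).abs).mul_const |g x|
        simpa using h2
      have l3 := (l1.add l2).const_mul C₂
      simp only [integral_zero, add_zero, mul_zero] at l3
      refine l3.congr fun n => ?_
      rw [integral_const_mul, integral_add (hi1 n) (hi2 n)]
  refine tendsto_nhds_unique hL (hR.neg.congr fun n => (hsm n).symm)

theorem hasDerivAt_sq_max_zero (s : ℝ) :
    HasDerivAt (fun s : ℝ => (max s 0) ^ 2) (2 * max s 0) s := by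
  rcases lt_trichotomy s 0 with hs | rfl | hs
  · rw [max_eq_right hs.le, mul_zero]
    refine (hasDerivAt_const s (0 : ℝ)).congr_of_eventuallyEq ?_
    filter_upwards [Iio_mem_nhds hs] with t ht
    rw [max_eq_right (le_of_lt ht)]
    norm_num
  · rw [max_self, mul_zero, hasDerivAt_iff_isLittleO_nhds_zero]
    have : (fun h : ℝ => h ^ 2) =o[𝓝 0] fun h => h := by
      simpa using Asymptotics.isLittleO_pow_id (𝕜 := ℝ) (n := 2) (by norm_num)
    refine Asymptotics.IsBigO.trans_isLittleO ?_ this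
    refine Asymptotics.IsBigO.of_bound 1 (Eventually.of_forall fun h => ?_)
    simp only [zero_add, max_self, smul_zero, sub_zero, one_mul, Real.norm_eq_abs, abs_pow]
    rw [zero_pow two_ne_zero, sub_zero, abs_pow]
    refine pow_le_pow_left₀ (abs_nonneg _) ?_ 2
    rw [abs_of_nonneg (le_max_right _ _)]
    exact max_le (le_abs_self _) (abs_nonneg _)
  · rw [max_eq_left hs.le]
    have h := hasDerivAt_pow 2 s
    simp only [Nat.cast_ofNat, Nat.add_one_sub_one, pow_one] at h
    refine h.congr_of_eventuallyEq ?_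
    filter_upwards [Ioi_mem_nhds hs] with t ht
    rw [max_eq_left (le_of_lt ht)]

/-- A continuously differentiable approximation of the positive part. -/
def smoothPos (ε s : ℝ) : ℝ := √((max s 0) ^ 2 + ε ^ 2) - ε

/-- The derivative of `smoothPos`. -/
def smoothPos' (ε s : ℝ) : ℝ := max s 0 / √((max s 0) ^ 2 + ε ^ 2)

theorem hasDerivAt_smoothPos {ε : ℝ} (hε : 0 < ε) (s : ℝ) :
    HasDerivAt (smoothPos ε) (smoothPos' ε s) s := by
  have h0 : (max s 0) ^ 2 + ε ^ 2 ≠ 0 := by positivity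
  have h := (((hasDerivAt_sq_max_zero s).add_const (ε ^ 2)).sqrt h0).sub_const ε
  refine HasDerivAt.congr_deriv (f := smoothPos ε) h ?_
  unfold smoothPos'
  rw [mul_div_mul_left _ _ two_ne_zero]

theorem continuous_smoothPos' {ε : ℝ} (hε : 0 < ε) : Continuous (smoothPos' ε) := by
  unfold smoothPos'
  refine Continuous.div (by fun_prop) (by fun_prop) fun s => ?_
  positivity

theorem smoothPos'_nonneg (ε s : ℝ) : 0 ≤ smoothPos' ε s := by
  unfold smoothPos'
  positivity

theorem abs_smoothPos'_le (ε s : ℝ) : |smoothPos' ε s| ≤ 1 := by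
  rw [abs_of_nonneg (smoothPos'_nonneg ε s)]
  refine div_le_one_of_le₀ ?_ (Real.sqrt_nonneg _)
  exact Real.le_sqrt_of_sq_le (by nlinarith)

theorem abs_smoothPos_le {ε : ℝ} (hε : 0 < ε) (s : ℝ) : |smoothPos ε s| ≤ |s| := by
  have h1 : ε ≤ √((max s 0) ^ 2 + ε ^ 2) := Real.le_sqrt_of_sq_le (by nlinarith [sq_nonneg (max s 0)])
  have h2 : √((max s 0) ^ 2 + ε ^ 2) ≤ max s 0 + ε := by
    refine Real.sqrt_le_iff.2 ⟨by positivity, ?_⟩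
    nlinarith [mul_nonneg (le_max_right s 0) hε.le]
  have h3 : max s 0 ≤ |s| := max_le (le_abs_self _) (abs_nonneg _)
  unfold smoothPos
  rw [abs_of_nonneg (by linarith)]
  linarith

theorem tendsto_smoothPos (s : ℝ) :
    Tendsto (fun ε => smoothPos ε s) (𝓝 0) (𝓝 (max s 0)) := by
  have : Continuous fun ε => smoothPos ε s := by
    unfold smoothPos
    fun_prop
  have h := this.tendsto 0
  simpa [smoothPos, Real.sqrt_sq (le_max_right s 0)] using h

/-- The approximation is flat on `s ≤ 0`, so the limit at `s = 0` is `0`. The gradient of the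
positive part thus comes out supported on `{u > 0}`, with no separate study of `{u = 0}`. -/
theorem tendsto_smoothPos' (s : ℝ) :
    Tendsto (fun ε => smoothPos' ε s) (𝓝 0) (𝓝 ({t : ℝ | 0 < t}.indicator 1 s)) := by
  by_cases hs : 0 < s
  · have : ContinuousAt (fun ε => smoothPos' ε s) 0 := by
      unfold smoothPos'
      refine ContinuousAt.div (by fun_prop) (by fun_prop) ?_
      rw [max_eq_left hs.le]
      positivity
    have h := this.tendsto
    simpa [smoothPos', hs, max_eq_left hs.le, Real.sqrt_sq hs.le, hs.ne'] using h
  · have h0 : max s 0 = 0 := max_eq_right (not_lt.1 hs)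
    simp [smoothPos', hs, h0]

theorem nullMeasurableSet_pos {u : Euc N → ℝ} (hu : AEStronglyMeasurable u volume) :
    NullMeasurableSet {x | 0 < u x} volume :=
  nullMeasurableSet_lt aemeasurable_const hu.aemeasurable

/-- The chain rule for the positive part of a weakly differentiable function. -/
theorem IsWeakGradient.posPart {u : Euc N → ℝ} {G : Euc N → Euc N} (hu : IsWeakGradient u G) :
    IsWeakGradient (fun x => max (u x) 0) ({x | 0 < u x}.indicator G) := by
  have hm : AEStronglyMeasurable u volume := hu.1.aestronglyMeasurable
  have hmG : AEStronglyMeasurable G volume := hu.2.1.aestronglyMeasurable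
  have hli : LocallyIntegrable (fun x => max (u x) 0) volume := by
    refine hu.1.of_norm_le (hm.sup aestronglyMeasurable_const) fun x => ?_
    rw [Real.norm_eq_abs, Real.norm_eq_abs, abs_of_nonneg (le_max_right _ _)]
    exact max_le (le_abs_self _) (abs_nonneg _)
  refine ⟨hli, hu.2.1.of_norm_le (hmG.indicator₀ (nullMeasurableSet_pos hm))
    fun x => norm_indicator_le_norm_self _ _, fun φ hφ hc e => ?_⟩
  set ε : ℕ → ℝ := fun n => 1 / ((n : ℝ) + 1) with hε
  have hε0 : ∀ n, 0 < ε n := fun n => by simp only [hε]; positivity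
  have hεl : Tendsto ε atTop (𝓝 0) := tendsto_one_div_add_atTop_nhds_zero_nat
  have key := fun n => hu.integral_comp_mul_fderiv (hasDerivAt_smoothPos (hε0 n))
    (continuous_smoothPos' (hε0 n)) (abs_smoothPos'_le (ε n)) hφ hc e
  have hL : Tendsto (fun n => ∫ x, smoothPos (ε n) (u x) * fderiv ℝ φ x e) atTop
      (𝓝 (∫ x, max (u x) 0 * fderiv ℝ φ x e)) := by
    refine tendsto_integral_of_dominated_convergence (fun x => ‖u x * fderiv ℝ φ x e‖)
      (fun n => ?_) (integrable_mul_fderiv hu.1 hφ hc e).norm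
      (fun n => Eventually.of_forall fun x => ?_) (Eventually.of_forall fun x => ?_)
    · have hcont : Continuous (smoothPos (ε n)) := by
        unfold smoothPos
        fun_prop
      exact (hcont.comp_aestronglyMeasurable hm).mul
        ((hφ.continuous_fderiv (by simp)).clm_apply continuous_const).aestronglyMeasurable
    · rw [norm_mul, norm_mul]
      exact mul_le_mul_of_nonneg_right (abs_smoothPos_le (hε0 n) _) (norm_nonneg _)
    · exact ((tendsto_smoothPos (u x)).comp hεl).mul_const _
  have hR : Tendsto (fun n => ∫ x, φ x * (smoothPos' (ε n) (u x) * inner ℝ (G x) e)) atTop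
      (𝓝 (∫ x, φ x * inner ℝ ({x | 0 < u x}.indicator G x) e)) := by
    refine tendsto_integral_of_dominated_convergence (fun x => ‖φ x * inner ℝ (G x) e‖)
      (fun n => ?_) (integrable_mul_inner hu.2.1 hφ.continuous hc e).norm
      (fun n => Eventually.of_forall fun x => ?_) (Eventually.of_forall fun x => ?_)
    · exact hφ.continuous.aestronglyMeasurable.mul
        (((continuous_smoothPos' (hε0 n)).comp_aestronglyMeasurable hm).mul
          (hmG.inner aestronglyMeasurable_const))
    · rw [norm_mul, norm_mul, norm_mul]
      exact mul_le_mul_of_nonneg_left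
        (mul_le_of_le_one_left (norm_nonneg _) (abs_smoothPos'_le _ _)) (norm_nonneg _)
    · have h := (((tendsto_smoothPos' (u x)).comp hεl).mul_const (inner ℝ (G x) e)).const_mul (φ x)
      have e1 : inner ℝ ({x | 0 < u x}.indicator G x) e =
          {t : ℝ | 0 < t}.indicator 1 (u x) * inner ℝ (G x) e := by
        by_cases hx : 0 < u x <;> simp [hx]
      rw [e1]
      exact h
  exact tendsto_nhds_unique hL (hR.neg.congr fun n => (key n).symm)

/-- Integration by parts for line derivatives of Lipschitz functions; it covers explicit functions
with a kink on a null set. -/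
theorem isWeakGradient_of_lipschitzWith {f : Euc N → ℝ} {F : Euc N → Euc N} {C : NNReal}
    (hf : LipschitzWith C f) (hF : LocallyIntegrable F volume)
    (hd : ∀ᵐ x, HasGradientAt f (F x) x) : IsWeakGradient f F := by
  refine ⟨hf.continuous.locallyIntegrable, hF, fun φ hφ hc e => ?_⟩
  obtain ⟨D, hD⟩ := (hφ.of_le (by simp : (1 : WithTop ℕ∞) ≤ ∞)).lipschitzWith_of_hasCompactSupport
    hc one_ne_zero
  have h := hf.integral_lineDeriv_mul_eq (μ := volume) hD hc e
  have e1 : ∀ x, lineDeriv ℝ φ x (-e) = -fderiv ℝ φ x e := fun x => by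
    rw [(hφ.differentiable (by simp) x).lineDeriv_eq_fderiv, map_neg]
  have e2 : ∫ x, lineDeriv ℝ f x e * φ x = ∫ x, φ x * inner ℝ (F x) e := by
    refine integral_congr_ae (hd.mono fun x hx => ?_)
    have := hx.hasFDerivAt
    simp only
    rw [this.differentiableAt.lineDeriv_eq_fderiv, this.fderiv, mul_comm]
    simp
  simp only [e1, neg_mul, integral_neg] at h
  rw [← e2, h, neg_neg]
  simp only [mul_comm]

theorem isWeakGradient_const (c : ℝ) : IsWeakGradient (fun _ : Euc N => c) 0 := by
  refine isWeakGradient_of_lipschitzWith (LipschitzWith.const c) (locallyIntegrable_const 0)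
    (Eventually.of_forall fun x => ?_)
  exact hasGradientAt_const x c

/-- A nonnegative compactly supported function with vanishing weak gradient is zero. -/
theorem IsWeakGradient.ae_eq_zero (hN : 0 < N) {u : Euc N → ℝ} (hu : IsWeakGradient u 0)
    (h0 : ∀ x, 0 ≤ u x) {K : Set (Euc N)} (hK : IsCompact K) (huK : ∀ᵐ x, x ∉ K → u x = 0) :
    u =ᵐ[volume] 0 := by
  obtain ⟨r, hr⟩ := hK.isBounded.subset_closedBall (0 : Euc N)
  set χ : ContDiffBump (0 : Euc N) := ⟨|r| + 1, |r| + 2, by positivity, by linarith⟩ with hχ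
  set e : Euc N := EuclideanSpace.single ⟨0, hN⟩ 1 with he
  -- This test function is a linear coordinate near `K`, so its derivative along `e` is `1` there
  -- and testing yields `∫ u = 0`.
  have hφ : ContDiff ℝ ∞ (fun x => χ x * inner ℝ x e) :=
    χ.contDiff.mul (contDiff_id.inner ℝ contDiff_const)
  have hc : HasCompactSupport (fun x => χ x * inner ℝ x e) := χ.hasCompactSupport.mul_right
  have h := hu.2.2 _ hφ hc e
  have e1 : ∫ x, u x * fderiv ℝ (fun x => χ x * inner ℝ x e) x e = ∫ x, u x := by
    refine integral_congr_ae (huK.mono fun x hx => ?_)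
    by_cases hxK : x ∈ K
    · have hx1 : x ∈ Metric.ball (0 : Euc N) (|r| + 1) := by
        have := hr hxK
        rw [Metric.mem_closedBall] at this
        rw [Metric.mem_ball]
        linarith [le_abs_self r]
      have hev : (fun x => χ x * inner ℝ x e) =ᶠ[𝓝 x] fun x => inner ℝ e x := by
        filter_upwards [Metric.isOpen_ball.mem_nhds hx1] with y hy
        rw [χ.one_of_mem_closedBall (Metric.ball_subset_closedBall hy), one_mul, real_inner_comm]
      have hd : fderiv ℝ (fun x => inner ℝ e x) x = innerSL ℝ e :=
        (innerSL ℝ e).hasFDerivAt.fderiv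
      simp only
      rw [hev.fderiv_eq, hd]
      simp [he]
    · simp [hx hxK]
  have e2 : ∫ x, u x = 0 := by
    rw [← e1, h]
    simp
  have hi : Integrable u volume := by
    refine (integrable_indicator_iff hK.measurableSet).2
      (hu.1.integrableOn_isCompact hK) |>.congr (huK.mono fun x hx => ?_)
    by_cases hxK : x ∈ K
    · simp [hxK]
    · simp [hxK, hx hxK]
  exact (integral_eq_zero_iff_of_nonneg h0 hi).1 e2

/-! ### Radial powers and the divergence of the continued radial field -/

/-- The truncated radial power `max(ρ, |y - x|)⁻ᵐ`. -/
def radialPow (x : Euc N) (ρ : ℝ) (m : ℕ) (y : Euc N) : ℝ := (max ρ ‖y - x‖)⁻¹ ^ m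

open Classical in
/-- The almost everywhere gradient of `radialPow`. -/
def radialPowGrad (x : Euc N) (ρ : ℝ) (m : ℕ) (y : Euc N) : Euc N :=
  if ρ < ‖y - x‖ then -((m : ℝ) * (‖y - x‖⁻¹) ^ (m + 2)) • (y - x) else 0

section Radial

variable {x : Euc N} {ρ : ℝ}

theorem radialPow_nonneg (hρ : 0 < ρ) (m : ℕ) (y : Euc N) : 0 ≤ radialPow x ρ m y := by
  unfold radialPow
  positivity

theorem radialPow_le (hρ : 0 < ρ) (m : ℕ) (y : Euc N) : radialPow x ρ m y ≤ ρ⁻¹ ^ m := by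
  unfold radialPow
  gcongr
  exact le_max_left _ _

theorem radialPow_of_le {y : Euc N} (m : ℕ) (hy : ‖y - x‖ ≤ ρ) :
    radialPow x ρ m y = ρ⁻¹ ^ m := by
  rw [radialPow, max_eq_left hy]

theorem radialPow_of_lt {y : Euc N} (m : ℕ) (hy : ρ < ‖y - x‖) :
    radialPow x ρ m y = ‖y - x‖⁻¹ ^ m := by
  rw [radialPow, max_eq_right hy.le]

/-- The truncation keeps the base of the power at most `ρ⁻¹`, away from the singularity at `x`. -/
theorem exists_lipschitzWith_radialPow (x : Euc N) (hρ : 0 < ρ) (m : ℕ) :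
    ∃ C, LipschitzWith C (radialPow x ρ m) := by
  refine ⟨_, LipschitzWith.of_dist_le' (K := ρ⁻¹ * ρ⁻¹ * m * ρ⁻¹ ^ (m - 1)) fun y z => ?_⟩
  rw [Real.dist_eq, radialPow, radialPow]
  set a := max ρ ‖y - x‖
  set b := max ρ ‖z - x‖
  have ha : ρ ≤ a := le_max_left _ _
  have hb : ρ ≤ b := le_max_left _ _
  have ha0 : 0 < a := hρ.trans_le ha
  have hb0 : 0 < b := hρ.trans_le hb
  have hai : a⁻¹ ≤ ρ⁻¹ := inv_anti₀ hρ ha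
  have hbi : b⁻¹ ≤ ρ⁻¹ := inv_anti₀ hρ hb
  have h1 : |a - b| ≤ dist y z := by
    have h := abs_max_sub_max_le_abs ‖y - x‖ ‖z - x‖ ρ
    rw [max_comm _ ρ, max_comm _ ρ] at h
    refine h.trans ((abs_norm_sub_norm_le _ _).trans ?_)
    rw [sub_sub_sub_cancel_right, dist_eq_norm]
  have h2 : |a⁻¹ - b⁻¹| ≤ ρ⁻¹ * ρ⁻¹ * dist y z := by
    have e : a⁻¹ - b⁻¹ = a⁻¹ * b⁻¹ * (b - a) := by
      field_simp
    rw [e, abs_mul, abs_of_pos (by positivity), abs_sub_comm]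
    gcongr
  refine (abs_pow_sub_pow_le _ _ _).trans ?_
  have h3 : max |a⁻¹| |b⁻¹| ≤ ρ⁻¹ := by
    rw [abs_of_pos (by positivity), abs_of_pos (by positivity)]
    exact max_le hai hbi
  calc |a⁻¹ - b⁻¹| * m * max |a⁻¹| |b⁻¹| ^ (m - 1)
      ≤ (ρ⁻¹ * ρ⁻¹ * dist y z) * m * ρ⁻¹ ^ (m - 1) := by gcongr
    _ = _ := by ring

theorem hasFDerivAt_norm_sub {y : Euc N} (hy : 0 < ‖y - x‖) :
    HasFDerivAt (fun y => ‖y - x‖) (‖y - x‖⁻¹ • innerSL ℝ (y - x)) y := by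
  have h := ((hasFDerivAt_id y).sub_const x).norm_sq
  have h2 := h.sqrt (by simpa using hy.ne')
  simp only [id, Real.sqrt_sq (norm_nonneg _)] at h2
  refine h2.congr_fderiv ?_
  ext z
  simp
  field_simp

theorem hasGradientAt_radialPow (hρ : 0 < ρ) (m : ℕ) {y : Euc N} (hy : ‖y - x‖ ≠ ρ) :
    HasGradientAt (radialPow x ρ m) (radialPowGrad x ρ m y) y := by
  have hc : Continuous fun y : Euc N => ‖y - x‖ := by fun_prop
  rcases lt_or_gt_of_ne hy with h | h
  · have h0 : radialPowGrad x ρ m y = 0 := if_neg (not_lt.2 h.le)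
    rw [h0]
    refine (hasGradientAt_const y (ρ⁻¹ ^ m)).congr_of_eventuallyEq ?_
    filter_upwards [(isOpen_lt hc continuous_const).mem_nhds h] with z hz
    exact radialPow_of_le m (le_of_lt hz)
  · have hpos : 0 < ‖y - x‖ := hρ.trans h
    have h1 : HasDerivAt (fun s : ℝ => s⁻¹ ^ m)
        ((m : ℝ) * ‖y - x‖⁻¹ ^ (m - 1) * -(‖y - x‖ ^ 2)⁻¹) ‖y - x‖ :=
      (hasDerivAt_inv hpos.ne').pow m
    have h2 := h1.comp_hasFDerivAt y (hasFDerivAt_norm_sub hpos)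
    rw [hasGradientAt_iff_hasFDerivAt]
    refine (h2.congr_fderiv ?_).congr_of_eventuallyEq ?_
    · ext z
      rw [radialPowGrad, if_pos h]
      simp only [_root_.smul_apply, innerSL_apply_apply, smul_eq_mul,
        InnerProductSpace.toDual_apply_apply, neg_smul, inner_neg_left, real_inner_smul_left]
      rcases m with _ | m
      · simp
      · rw [Nat.add_sub_cancel, ← inv_pow]
        ring
    · filter_upwards [(isOpen_lt continuous_const hc).mem_nhds h] with z hz
      exact radialPow_of_lt m hz

theorem norm_radialPowGrad_le (hρ : 0 < ρ) (m : ℕ) (y : Euc N) :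
    ‖radialPowGrad x ρ m y‖ ≤ m * ρ⁻¹ ^ (m + 1) := by
  unfold radialPowGrad
  split_ifs with h
  · have hpos : 0 < ‖y - x‖ := hρ.trans h
    rw [norm_smul, norm_neg, Real.norm_of_nonneg (by positivity)]
    have e : (m : ℝ) * ‖y - x‖⁻¹ ^ (m + 2) * ‖y - x‖ = m * ‖y - x‖⁻¹ ^ (m + 1) := by
      rw [pow_succ, mul_assoc, mul_assoc, inv_mul_cancel₀ hpos.ne', mul_one]
    rw [e]
    gcongr
  · rw [norm_zero]
    positivity

theorem measurable_radialPowGrad (m : ℕ) : Measurable (radialPowGrad x ρ m) := by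
  unfold radialPowGrad
  exact Measurable.ite (measurableSet_lt measurable_const (by fun_prop)) (by fun_prop)
    measurable_const

theorem isWeakGradient_radialPow [NeZero N] (x : Euc N) (hρ : 0 < ρ) (m : ℕ) :
    IsWeakGradient (radialPow x ρ m) (radialPowGrad x ρ m) := by
  obtain ⟨C, hC⟩ := exists_lipschitzWith_radialPow x hρ m
  refine isWeakGradient_of_lipschitzWith hC ?_ ?_
  · refine (locallyIntegrable_const ((m : ℝ) * ρ⁻¹ ^ (m + 1))).of_norm_le
      (measurable_radialPowGrad m).aestronglyMeasurable fun y => ?_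
    exact (norm_radialPowGrad_le hρ m y).trans (le_abs_self _)
  · have h0 : volume (Metric.sphere x ρ) = 0 := Measure.addHaar_sphere_of_ne_zero _ _ hρ.ne'
    filter_upwards [measure_eq_zero_iff_ae_notMem.1 h0] with y hy
    refine hasGradientAt_radialPow hρ m fun h => hy ?_
    rwa [mem_sphere_iff_norm]

theorem sum_coord_smul_single (z : Euc N) :
    ∑ i, z i • EuclideanSpace.single i (1 : ℝ) = z := by
  have := (EuclideanSpace.basisFun (Fin N) ℝ).sum_repr z
  simpa using this

theorem inner_single_one (z : Euc N) (i : Fin N) :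
    inner ℝ z (EuclideanSpace.single i (1 : ℝ)) = z i := by
  simp [EuclideanSpace.inner_single_right]

theorem hasFDerivAt_coord_sub (x y : Euc N) (i : Fin N) :
    HasFDerivAt (fun y : Euc N => (y - x) i) (innerSL ℝ (EuclideanSpace.single i (1 : ℝ))) y := by
  have h : HasFDerivAt (fun y : Euc N => innerSL ℝ (EuclideanSpace.single i (1 : ℝ)) (y - x))
      _ y := (innerSL ℝ (EuclideanSpace.single i (1 : ℝ))).hasFDerivAt.comp y
    ((hasFDerivAt_id y).sub_const x)
  simp only [innerSL_apply_apply, real_inner_comm _ (EuclideanSpace.single i (1 : ℝ)),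
    inner_single_one] at h
  exact h.congr_fderiv (ContinuousLinearMap.comp_id _)

theorem contDiff_coord_sub (x : Euc N) (i : Fin N) : ContDiff ℝ ∞ fun y : Euc N => (y - x) i := by
  have h : ContDiff ℝ ∞ fun y : Euc N =>
      innerSL ℝ (EuclideanSpace.single i (1 : ℝ)) (y - x) :=
    (innerSL ℝ (EuclideanSpace.single i (1 : ℝ))).contDiff.comp (contDiff_id.sub contDiff_const)
  simpa only [innerSL_apply_apply, real_inner_comm _ (EuclideanSpace.single i (1 : ℝ)),
    inner_single_one] using h

/-- The divergence of the vector field `max(ρ, |y - x|)⁻ᴺ (y - x)`, tested with a smooth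
function. -/
theorem sum_integral_radialPow_mul_fderiv [NeZero N] (x : Euc N) (hρ : 0 < ρ) {ψ : Euc N → ℝ}
    (hψ : ContDiff ℝ ∞ ψ) (hc : HasCompactSupport ψ) :
    ∑ i, ∫ y, radialPow x ρ N y * (y - x) i * fderiv ℝ ψ y (EuclideanSpace.single i 1) =
      -∫ y, (Metric.closedBall x ρ).indicator (fun _ => (N : ℝ) * ρ⁻¹ ^ N) y * ψ y := by
  set κ := radialPow x ρ N with hκ
  set G := radialPowGrad x ρ N with hG
  have hw := isWeakGradient_radialPow x hρ N
  obtain ⟨C, hC⟩ := exists_lipschitzWith_radialPow x hρ N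
  have hκc : Continuous κ := hC.continuous
  have hi : ∀ i : Fin N,
      ∫ y, κ y * (y - x) i * fderiv ℝ ψ y (EuclideanSpace.single i 1) =
        -∫ y, (κ y + (y - x) i * G y i) * ψ y := by
    intro i
    -- Moving the coordinate into the test function leaves only the weak gradient of the scalar
    -- factor `κ`.
    have hη : ContDiff ℝ ∞ fun y : Euc N => (y - x) i * ψ y := (contDiff_coord_sub x i).mul hψ
    have hηc : HasCompactSupport fun y : Euc N => (y - x) i * ψ y := hc.mul_left
    have h := hw.2.2 _ hη hηc (EuclideanSpace.single i 1)
    have hd : ∀ y, fderiv ℝ (fun y : Euc N => (y - x) i * ψ y) y (EuclideanSpace.single i 1) =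
        (y - x) i * fderiv ℝ ψ y (EuclideanSpace.single i 1) + ψ y := by
      intro y
      have h1 : HasFDerivAt (fun y : Euc N => (y - x) i * ψ y) _ y :=
        (hasFDerivAt_coord_sub x y i).mul (hψ.differentiable (by simp) y).hasFDerivAt
      rw [h1.fderiv]
      simp
    have j1 : Integrable
        (fun y => κ y * (y - x) i * fderiv ℝ ψ y (EuclideanSpace.single i 1)) volume := by
      refine Continuous.integrable_of_hasCompactSupport
        ((hκc.mul (contDiff_coord_sub x i).continuous).mul
          ((hψ.continuous_fderiv (by simp)).clm_apply continuous_const)) ?_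
      exact (hc.fderiv_apply ℝ _).mul_left
    have j2 : Integrable (fun y => κ y * ψ y) volume :=
      (hκc.mul hψ.continuous).integrable_of_hasCompactSupport hc.mul_left
    have j3 := IsWeakGradient.integrable_mul_inner hw.2.1 hη.continuous hηc
      (EuclideanSpace.single i 1)
    have e1 : ∫ y, κ y * fderiv ℝ (fun y : Euc N => (y - x) i * ψ y) y
        (EuclideanSpace.single i 1) =
        (∫ y, κ y * (y - x) i * fderiv ℝ ψ y (EuclideanSpace.single i 1)) +
          ∫ y, κ y * ψ y := by
      rw [← integral_add j1 j2]
      congr 1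
      ext y
      rw [hd]
      ring
    have e2 : ∫ y, (κ y + (y - x) i * G y i) * ψ y = (∫ y, κ y * ψ y) +
        ∫ y, (y - x) i * ψ y * inner ℝ (G y) (EuclideanSpace.single i 1) := by
      rw [← integral_add j2 j3]
      congr 1
      ext y
      rw [inner_single_one]
      ring
    rw [e2]
    linarith
  have hint : ∀ i : Fin N, Integrable (fun y => (κ y + (y - x) i * G y i) * ψ y) volume := by
    intro i
    have j2 : Integrable (fun y => κ y * ψ y) volume :=
      (hκc.mul hψ.continuous).integrable_of_hasCompactSupport hc.mul_left
    have j3 := IsWeakGradient.integrable_mul_inner hw.2.1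
      ((contDiff_coord_sub x i).continuous.mul hψ.continuous) hc.mul_left
      (EuclideanSpace.single i 1)
    refine (j2.add j3).congr (Eventually.of_forall fun y => ?_)
    simp only [inner_single_one, Pi.mul_apply, Pi.add_apply]
    ring
  simp only [hi]
  rw [Finset.sum_neg_distrib, ← integral_finsetSum _ fun i _ => hint i]
  congr 2
  ext y
  rw [← Finset.sum_mul, Finset.sum_add_distrib]
  congr 1
  simp only [Finset.sum_const, Finset.card_univ, Fintype.card_fin, nsmul_eq_mul]
  by_cases hy : y ∈ Metric.closedBall x ρ
  · rw [indicator_of_mem hy]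
    rw [mem_closedBall_iff_norm] at hy
    simp [hG, hκ, radialPowGrad, not_lt.2 hy, radialPow_of_le N hy]
  · rw [indicator_of_notMem hy]
    rw [mem_closedBall_iff_norm, not_le] at hy
    have hpos : 0 < ‖y - x‖ := hρ.trans hy
    have e3 : ∑ i, (y - x) i * (y - x) i = ‖y - x‖ ^ 2 := by
      rw [EuclideanSpace.norm_sq_eq]
      simp [sq]
    have e4 : ∀ i, (y - x) i * G y i =
        -((N : ℝ) * ‖y - x‖⁻¹ ^ (N + 2)) * ((y - x) i * (y - x) i) := by
      intro i
      simp only [hG, radialPowGrad, if_pos hy, PiLp.smul_apply, smul_eq_mul]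
      ring
    simp only [e4]
    -- Outside the ball the divergence is `N |y - x|⁻ᴺ - N |y - x|⁻ᴺ = 0`; this is why the exponent
    -- is the dimension.
    rw [← Finset.mul_sum, e3, hκ, radialPow_of_lt N hy, pow_add]
    field_simp
    ring

/-- The divergence of the vector field `max(ρ, |y - x|)⁻ᴺ (y - x)`, tested with a weakly
differentiable function supported in a ball. -/
theorem IsWeakGradient.integral_radialPow_mul_inner [NeZero N] (x : Euc N) (hρ : 0 < ρ) {R : ℝ}
    {f : Euc N → ℝ} {F : Euc N → Euc N} (hf : IsWeakGradient f F)
    (hf0 : ∀ y, y ∉ Metric.closedBall x R → f y = 0)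
    (hF0 : ∀ y, y ∉ Metric.closedBall x R → F y = 0) :
    ∫ y, radialPow x ρ N y * inner ℝ (F y) (y - x) =
      -∫ y, (Metric.closedBall x ρ).indicator (fun _ => (N : ℝ) * ρ⁻¹ ^ N) y * f y := by
  set κ := radialPow x ρ N with hκ
  obtain ⟨C, hC⟩ := exists_lipschitzWith_radialPow x hρ N
  have hκc : Continuous κ := hC.continuous
  -- Mollification enlarges supports by at most `1`.
  set K := Metric.closedBall x (R + 1) with hK
  have hKc : IsCompact K := isCompact_closedBall _ _
  have hsub : Metric.closedBall x R ⊆ K := Metric.closedBall_subset_closedBall (by linarith)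
  have hmoll0 : ∀ {g : Euc N → ℝ}, (∀ y, y ∉ Metric.closedBall x R → g y = 0) →
      ∀ n y, y ∉ K → mollify n g y = 0 := fun hg n y hy =>
    mollify_eq_zero (Eventually.of_forall hg) n hy
  have hcs : ∀ {g : Euc N → ℝ}, (∀ y, y ∉ K → g y = 0) → HasCompactSupport g :=
    fun h => HasCompactSupport.intro hKc fun y hy => h y hy
  have hintK : ∀ {g : Euc N → ℝ}, LocallyIntegrable g volume →
      (∀ y, y ∉ K → g y = 0) → Integrable g volume := by
    intro g hg h0
    rw [← integrableOn_iff_integrable_of_support_subset (s := K)]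
    · exact hg.integrableOn_isCompact hKc
    · intro y hy
      by_contra h
      exact hy (h0 y h)
  have hlim : ∀ {g a : Euc N → ℝ} {A : ℝ}, LocallyIntegrable g volume →
      (∀ y, y ∉ Metric.closedBall x R → g y = 0) → Measurable a → (∀ y ∈ K, |a y| ≤ A) →
      (∀ y, y ∉ K → a y = 0) →
      Tendsto (fun n => ∫ y, a y * mollify n g y) atTop (𝓝 (∫ y, a y * g y)) := by
    intro g a A hg hg0 ha hA ha0
    have hb : ∀ {k : Euc N → ℝ}, Integrable k volume →
        Integrable (fun y => a y * k y) volume := by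
      intro k hk
      refine hk.bdd_mul (c := |A|) ha.aestronglyMeasurable (Eventually.of_forall fun y => ?_)
      by_cases hy : y ∈ K
      · exact (hA y hy).trans (le_abs_self _)
      · simp [ha0 y hy]
    have hmi := fun n => hintK (contDiff_mollify hg n).continuous.locallyIntegrable
      (hmoll0 hg0 n)
    have hgi : Integrable g volume := hintK hg fun y hy => hg0 y fun h => hy (hsub h)
    refine tendsto_integral_of_abs_sub_le (K := K) (H := fun n y => A * |mollify n g y - g y|)
      hKc.measurableSet (fun n => hb (hmi n)) (hb hgi)
      (fun n => (((hmi n).sub hgi).abs.const_mul A).integrableOn) (fun n y => ?_) ?_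
    · by_cases hy : y ∈ K
      · rw [indicator_of_mem hy, ← mul_sub, abs_mul]
        exact mul_le_mul_of_nonneg_right (hA y hy) (abs_nonneg _)
      · simp [hy, ha0 y hy]
    · have := (tendsto_setIntegral_abs_mollify_sub hg hKc).const_mul A
      simpa only [integral_const_mul, mul_zero] using this
  have key := fun n => sum_integral_radialPow_mul_fderiv x hρ (contDiff_mollify hf.1 n)
    (hcs (hmoll0 hf0 n))
  set a : Fin N → Euc N → ℝ := fun i => K.indicator fun y => κ y * (y - x) i with ha
  have hac : ∀ i, Continuous fun y => κ y * (y - x) i := fun i =>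
    hκc.mul (contDiff_coord_sub x i).continuous
  have haK : ∀ i, ∃ A, ∀ y ∈ K, |a i y| ≤ A := by
    intro i
    obtain ⟨A, hA⟩ := hKc.exists_bound_of_continuousOn (hac i).continuousOn
    refine ⟨A, fun y hy => ?_⟩
    simp only [ha, indicator_of_mem hy]
    exact hA y hy
  choose A hA using haK
  set g : Fin N → Euc N → ℝ := fun i y => inner ℝ (F y) (EuclideanSpace.single i 1) with hg
  have hg0 : ∀ i y, y ∉ Metric.closedBall x R → g i y = 0 := by
    intro i y hy
    simp [hg, hF0 y hy]
  have hgl : ∀ i, LocallyIntegrable (g i) volume := fun i => hf.2.1.inner_right _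
  have hL : Tendsto (fun n => ∑ i, ∫ y, a i y * mollify n (g i) y) atTop
      (𝓝 (∑ i, ∫ y, a i y * g i y)) :=
    tendsto_finsetSum _ fun i _ => hlim (hgl i) (hg0 i)
      ((hac i).measurable.indicator hKc.measurableSet) (hA i)
      (fun y hy => indicator_of_notMem hy _)
  have eL : ∀ n, ∑ i, ∫ y, a i y * mollify n (g i) y =
      ∑ i, ∫ y, κ y * (y - x) i *
        fderiv ℝ (mollify n f) y (EuclideanSpace.single i 1) := by
    intro n
    refine Finset.sum_congr rfl fun i _ => ?_
    congr 1
    ext y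
    rw [fderiv_mollify hf]
    by_cases hy : y ∈ K
    · simp only [ha, indicator_of_mem hy]
      rfl
    · have := hmoll0 (hg0 i) n y hy
      change _ = _ * mollify n (g i) y
      rw [this, mul_zero, mul_zero]
  set d : Euc N → ℝ := (Metric.closedBall x ρ).indicator (fun _ => (N : ℝ) * ρ⁻¹ ^ N) with hd
  have hR : Tendsto (fun n => ∫ y, K.indicator d y * mollify n f y) atTop
      (𝓝 (∫ y, K.indicator d y * f y)) := by
    refine hlim (A := (N : ℝ) * ρ⁻¹ ^ N) hf.1 hf0
      ((measurable_const.indicator Metric.isClosed_closedBall.measurableSet).indicator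
        hKc.measurableSet) (fun y hy => ?_) (fun y hy => indicator_of_notMem hy _)
    rw [indicator_of_mem hy, hd, ← Real.norm_eq_abs]
    refine (norm_indicator_le_norm_self _ _).trans ?_
    rw [Real.norm_of_nonneg (by positivity)]
  have eR : ∀ n, ∫ y, K.indicator d y * mollify n f y = ∫ y, d y * mollify n f y := by
    intro n
    congr 1
    ext y
    by_cases hy : y ∈ K
    · rw [indicator_of_mem hy]
    · rw [hmoll0 hf0 n y hy, mul_zero, mul_zero]
  have eR0 : ∫ y, K.indicator d y * f y = ∫ y, d y * f y := by
    congr 1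
    ext y
    by_cases hy : y ∈ K
    · rw [indicator_of_mem hy]
    · rw [hf0 y fun h => hy (hsub h), mul_zero, mul_zero]
  have hmain : ∑ i, ∫ y, a i y * g i y = -∫ y, d y * f y := by
    rw [← eR0]
    refine tendsto_nhds_unique hL (hR.neg.congr fun n => ?_)
    rw [eL, eR, key]
  rw [← hmain, ← integral_finsetSum]
  · congr 1
    ext y
    by_cases hy : y ∈ Metric.closedBall x R
    · simp only [ha, indicator_of_mem (hsub hy), hg]
      conv_lhs => rw [← sum_coord_smul_single (y - x), inner_sum, Finset.mul_sum]
      refine Finset.sum_congr rfl fun i _ => ?_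
      rw [real_inner_smul_right]
      ring
    · rw [hF0 y hy, inner_zero_left, mul_zero, Finset.sum_eq_zero]
      intro i _
      rw [hg0 i y hy, mul_zero]
  · intro i _
    refine (hintK (hgl i) fun y hy => hg0 i y fun h => hy (hsub h)).bdd_mul (c := |A i|)
      ((hac i).measurable.indicator hKc.measurableSet).aestronglyMeasurable
      (Eventually.of_forall fun y => ?_)
    by_cases hy : y ∈ K
    · exact (hA i y hy).trans (le_abs_self _)
    · simp [ha, hy]

end Radial

/-! ### The signed distance and the weight -/

/-- The segment from `y` to `x` meets `∂Ω` at some `z`, and `|z - x| ≥ r` leaves at most `|y - x| -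
r` for `|y - z|`. -/
theorem infDist_frontier_le {Ω : Set (Euc N)} {x y : Euc N} {r : ℝ} (hx : x ∉ closure Ω)
    (hr : r ≤ Metric.infDist x Ω) (hy : y ∈ Ω) :
    Metric.infDist y (frontier Ω) ≤ dist y x - r := by
  have hcross : ∃ z ∈ segment ℝ y x, z ∈ frontier Ω := by
    by_contra! hne
    have hyi : y ∈ interior Ω := by
      by_contra h
      exact hne y (left_mem_segment ℝ y x) ⟨subset_closure hy, h⟩
    obtain ⟨z, -, hz1, hz2⟩ := (convex_segment (𝕜 := ℝ) y x).isPreconnected (interior Ω)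
      (closure Ω)ᶜ isOpen_interior isClosed_closure.isOpen_compl
      (fun z hz => or_iff_not_imp_left.2 fun h hc => hne z hz ⟨hc, h⟩)
      ⟨y, left_mem_segment ℝ y x, hyi⟩ ⟨x, right_mem_segment ℝ y x, hx⟩
    exact hz2 (subset_closure (interior_subset hz1))
  obtain ⟨z, hz, hzf⟩ := hcross
  have h1 := dist_add_dist_of_mem_segment hz
  have h2 : r ≤ dist x z := by
    refine hr.trans ?_
    rw [← Metric.infDist_closure]
    exact Metric.infDist_le_dist_of_mem (frontier_subset_closure hzf)
  have h3 := Metric.infDist_le_dist_of_mem (x := y) hzf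
  rw [dist_comm x z] at h2
  linarith

theorem sub_dist_le_sdist {Ω : Set (Euc N)} {x : Euc N} {r : ℝ} (hx : x ∉ closure Ω)
    (hr : r ≤ Metric.infDist x Ω) (y : Euc N) : r - dist y x ≤ sdist Ω y := by
  unfold sdist
  split_ifs with hy
  · linarith [infDist_frontier_le hx hr hy]
  · have := Metric.infDist_le_infDist_add_dist (s := Ω) (x := x) (y := y)
    rw [dist_comm] at this
    linarith

/-- The weight `(1 + d^s_Ω / h)_+` of the positivity set in `J`. -/
def weight (h : ℝ) (Ω : Set (Euc N)) (y : Euc N) : ℝ := max (1 + 1 / h * sdist Ω y) 0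

theorem weight_nonneg (h : ℝ) (Ω : Set (Euc N)) (y : Euc N) : 0 ≤ weight h Ω y :=
  le_max_right _ _

theorem measurable_weight (h : ℝ) {Ω : Set (Euc N)} (hΩ : IsOpen Ω) :
    Measurable (weight h Ω) := by
  have : Measurable (sdist Ω) := by
    unfold sdist
    exact Measurable.ite hΩ.measurableSet (Metric.continuous_infDist_pt _).measurable.neg
      (Metric.continuous_infDist_pt _).measurable
  exact ((this.const_mul _).const_add _).max measurable_const

theorem weight_le (h : ℝ) (Ω : Set (Euc N)) (y : Euc N) :
    weight h Ω y ≤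
      1 + |1 / h| * (Metric.infDist y (frontier Ω) + Metric.infDist y Ω) := by
  have h1 : |sdist Ω y| ≤ Metric.infDist y (frontier Ω) + Metric.infDist y Ω := by
    have a := Metric.infDist_nonneg (x := y) (s := Ω)
    have b := Metric.infDist_nonneg (x := y) (s := frontier Ω)
    unfold sdist
    split_ifs
    · rw [abs_neg, abs_of_nonneg b]
      linarith
    · rw [abs_of_nonneg a]
      linarith
  have h2 : 1 / h * sdist Ω y ≤ |1 / h| * |sdist Ω y| := by
    rw [← abs_mul]
    exact le_abs_self _
  have h3 := mul_le_mul_of_nonneg_left h1 (abs_nonneg (1 / h))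
  refine max_le (by linarith) ?_
  have := mul_nonneg (abs_nonneg (1 / h)) (abs_nonneg (sdist Ω y))
  linarith

/-! ### Minimality and truncation at height one -/

/-- The integrand of `J` for the function `u` with gradient `G`. -/
def energyDensity (h : ℝ) (Ω : Set (Euc N)) (u : Euc N → ℝ) (G : Euc N → Euc N) (y : Euc N) : ℝ :=
  ‖G y‖ ^ 2 + indicator {y | 0 < u y} (weight h Ω) y

theorem J_eq (S : Set (Euc N)) (h : ℝ) (Ω : Set (Euc N)) (u : Euc N → ℝ) :
    J S h Ω u = ∫ y in Sᶜ, energyDensity h Ω u (weakGrad u) y := rfl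

/-- The weight may be unbounded, but `u` vanishes a.e. outside a compact set, where a continuous
bound suffices. Integrability lets energies be compared pointwise. -/
theorem integrable_energyDensity {S : Set (Euc N)} (h : ℝ) {Ω : Set (Euc N)} (hΩ : IsOpen Ω)
    {u : Euc N → ℝ} (hu : u ∈ admissible S) :
    Integrable (energyDensity h Ω u (weakGrad u)) volume := by
  obtain ⟨h1, -, -, K, hK, huK⟩ := hu
  refine Integrable.add ?_ ?_
  · exact h1.memLp_weakGrad.integrable_norm_pow (by norm_num)
  · have hcont : Continuous fun y : Euc N =>
        1 + |1 / h| * (Metric.infDist y (frontier Ω) + Metric.infDist y Ω) :=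
      continuous_const.add (continuous_const.mul
        ((Metric.continuous_infDist_pt _).add (Metric.continuous_infDist_pt _)))
    have hi := (integrable_indicator_iff hK.measurableSet).2
      (hcont.continuousOn.integrableOn_compact hK (μ := volume))
    refine hi.mono' (((measurable_weight h hΩ).aestronglyMeasurable).indicator₀
      (nullMeasurableSet_pos h1.1.aestronglyMeasurable)) (huK.mono fun y hy => ?_)
    by_cases hp : 0 < u y
    · have hyK : y ∈ K := by
        by_contra hyK
        exact hp.ne' (hy hyK)
      rw [indicator_of_mem (show y ∈ {y | 0 < u y} from hp), indicator_of_mem hyK,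
        Real.norm_of_nonneg (weight_nonneg _ _ _)]
      exact weight_le h Ω y
    · rw [indicator_of_notMem (show y ∉ {y | 0 < u y} from hp), norm_zero]
      refine indicator_nonneg (fun z _ => ?_) y
      exact (weight_nonneg h Ω z).trans (weight_le h Ω z)

/-- The minimality of `u` tested with the competitor `u - f`. -/
theorem IsMinimizer.integral_nonneg {S : Set (Euc N)} {h : ℝ}
    {Ω : Set (Euc N)} (hΩ : IsOpen Ω) {u : Euc N → ℝ} (hu : IsMinimizer S h Ω u)
    {f : Euc N → ℝ} {F : Euc N → Euc N} (hf : IsWeakGradient f F) (hf2 : MemLp f 2 volume)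
    (hft : MemLp f ⊤ volume) (hF : MemLp F 2 volume) (hfS : ∀ᵐ y, y ∈ S → f y = 0)
    (hfK : ∃ K : Set (Euc N), IsCompact K ∧ ∀ᵐ y, y ∉ K → f y = 0)
    {B : Euc N → ℝ} (hB : Integrable B volume) (hBS : ∀ᵐ y, y ∈ S → B y = 0)
    (hle : ∀ᵐ y, energyDensity h Ω (fun y => u y - f y) (fun y => weakGrad u y - F y) y ≤
      energyDensity h Ω u (weakGrad u) y + B y) : 0 ≤ ∫ y, B y := by
  obtain ⟨huA, hmin⟩ := hu
  obtain ⟨hH1, hLt, h1S, K, hK, huK⟩ := id huA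
  obtain ⟨K', hK', hfK'⟩ := hfK
  have hwg : IsWeakGradient (fun y => u y - f y) (fun y => weakGrad u y - F y) :=
    hH1.isWeakGradient.sub hf
  have hvA : (fun y => u y - f y) ∈ admissible S := by
    refine ⟨⟨hH1.1.sub hf2, _, hwg, hH1.memLp_weakGrad.sub hF⟩, hLt.sub hft, ?_, K ∪ K',
      hK.union hK', ?_⟩
    · filter_upwards [h1S, hfS] with y h1 h2 hy
      rw [h1 hy, h2 hy, sub_zero]
    · filter_upwards [huK, hfK'] with y h1 h2 hy
      rw [mem_union, not_or] at hy
      rw [h1 hy.1, h2 hy.2, sub_zero]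
  have hJ : J S h Ω u ≤ J S h Ω (fun y => u y - f y) := hmin hvA
  have hae : weakGrad (fun y => u y - f y) =ᵐ[volume] fun y => weakGrad u y - F y :=
    hvA.1.isWeakGradient.ae_eq hwg EventuallyEq.rfl
  have hiu := integrable_energyDensity h hΩ huA
  have hiv := integrable_energyDensity h hΩ hvA
  have h2 : J S h Ω (fun y => u y - f y) ≤ J S h Ω u + ∫ y in Sᶜ, B y := by
    rw [J_eq, J_eq, ← integral_add hiu.integrableOn hB.integrableOn]
    refine integral_mono_ae hiv.integrableOn (hiu.add hB).integrableOn (ae_restrict_of_ae ?_)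
    filter_upwards [hae, hle] with y hy hy2
    refine le_trans (le_of_eq ?_) hy2
    simp only [energyDensity, hy]
  -- `B` vanishes a.e. on `S`, so the divergence identity on the whole space can be used later.
  have h3 : ∫ y in Sᶜ, B y = ∫ y, B y := by
    refine setIntegral_eq_integral_of_ae_compl_eq_zero ?_
    filter_upwards [hBS] with y hy hy'
    exact hy (not_not.1 hy')
  linarith

theorem energyDensity_of_pos {h : ℝ} {Ω : Set (Euc N)} {u : Euc N → ℝ} {G : Euc N → Euc N}
    {y : Euc N} (hy : 0 < u y) : energyDensity h Ω u G y = ‖G y‖ ^ 2 + weight h Ω y := by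
  rw [energyDensity, indicator_of_mem (show y ∈ {y | 0 < u y} from hy)]

theorem energyDensity_of_nonpos {h : ℝ} {Ω : Set (Euc N)} {u : Euc N → ℝ} {G : Euc N → Euc N}
    {y : Euc N} (hy : u y ≤ 0) : energyDensity h Ω u G y = ‖G y‖ ^ 2 := by
  rw [energyDensity, indicator_of_notMem (show y ∉ {y | 0 < u y} from not_lt.2 hy), add_zero]

/-- The competitor `min(u, 1)` has the same positivity set and loses `∫ |∇(u - 1)_+|²`. Hence `(u -
1)_+` has zero gradient and, having compact support, vanishes. -/
theorem IsMinimizer.ae_le_one (hN : 0 < N) {S : Set (Euc N)} {h : ℝ}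
    {Ω : Set (Euc N)} (hΩ : IsOpen Ω) {u : Euc N → ℝ} (hu : IsMinimizer S h Ω u) :
    ∀ᵐ y, u y ≤ 1 := by
  obtain ⟨hH1, hLt, h1S, K, hK, huK⟩ := hu.1
  set G := weakGrad u with hG
  have hwg : IsWeakGradient (fun y => max (u y - 1) 0)
      ({y | 0 < u y - 1}.indicator fun y => G y - (0 : Euc N → Euc N) y) :=
    (hH1.isWeakGradient.sub (isWeakGradient_const 1)).posPart
  simp only [Pi.zero_apply, sub_zero] at hwg
  set f : Euc N → ℝ := fun y => max (u y - 1) 0 with hf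
  set F : Euc N → Euc N := {y | 0 < u y - 1}.indicator fun y => G y with hF
  have hfm : AEStronglyMeasurable f volume := hwg.1.aestronglyMeasurable
  have hFm : AEStronglyMeasurable F volume := hwg.2.1.aestronglyMeasurable
  have hfu : ∀ y, ‖f y‖ ≤ ‖u y‖ := fun y => by
    rw [Real.norm_of_nonneg (le_max_right _ _), Real.norm_eq_abs]
    exact max_le (by linarith [le_abs_self (u y)]) (abs_nonneg _)
  have hF2 : MemLp F 2 volume := hH1.memLp_weakGrad.mono hFm
    (Eventually.of_forall fun y => norm_indicator_le_norm_self _ _)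
  have hint : Integrable (fun y => ‖F y‖ ^ 2) volume := hF2.integrable_norm_pow (by norm_num)
  have hfK : ∀ᵐ y, y ∉ K → f y = 0 := huK.mono fun y hy hyK => by simp [hf, hy hyK]
  have hB := hu.integral_nonneg hΩ hwg (hH1.1.mono hfm (Eventually.of_forall hfu))
    (hLt.mono hfm (Eventually.of_forall hfu)) hF2
    (h1S.mono fun y hy hyS => by simp [hf, hy hyS]) ⟨K, hK, hfK⟩ (B := fun y => -‖F y‖ ^ 2)
    hint.neg (h1S.mono fun y hy hyS => by simp [hF, hy hyS])
    (Eventually.of_forall fun y => ?_)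
  · rw [integral_neg] at hB
    have h0 : ∫ y, ‖F y‖ ^ 2 = 0 :=
      le_antisymm (by linarith) (MeasureTheory.integral_nonneg fun y => by positivity)
    have h1 := (integral_eq_zero_iff_of_nonneg (fun y => by positivity) hint).1 h0
    have h2 : F =ᵐ[volume] 0 := h1.mono fun y hy => by simpa using hy
    have h3 := (hwg.congr EventuallyEq.rfl h2).ae_eq_zero hN (fun y => le_max_right _ _) hK hfK
    filter_upwards [h3] with y hy
    have := le_max_left (u y - 1) 0
    change max (u y - 1) 0 = 0 at hy
    linarith
  · by_cases hy : 0 < u y - 1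
    · have e1 : f y = u y - 1 := max_eq_left hy.le
      have e2 : F y = G y := indicator_of_mem (show y ∈ {y | 0 < u y - 1} from hy) _
      rw [energyDensity_of_pos (by rw [e1]; linarith), energyDensity_of_pos (by linarith), e2]
      simp [hG]
    · have e1 : f y = 0 := max_eq_right (not_lt.1 hy)
      have e2 : F y = 0 := indicator_of_notMem (show y ∉ {y | 0 < u y - 1} from hy) _
      simp only [energyDensity, e2, sub_zero, norm_zero]
      simp [indicator, e1]

/-! ### The radial barrier -/

theorem IsWeakGradient.const_mul {u : Euc N → ℝ} {G : Euc N → Euc N} (h : IsWeakGradient u G)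
    (c : ℝ) : IsWeakGradient (fun x => c * u x) (fun x => c • G x) := by
  refine ⟨h.1.smul c, h.2.1.smul c, fun φ hφ hc e => ?_⟩
  have e1 : ∀ x, c * u x * fderiv ℝ φ x e = c * (u x * fderiv ℝ φ x e) := fun x => by ring
  have e2 : ∀ x, φ x * inner ℝ (c • G x) e = c * (φ x * inner ℝ (G x) e) := fun x => by
    rw [real_inner_smul_left]
    ring
  simp only [e1, e2, integral_const_mul, h.2.2 φ hφ hc e, mul_neg]

/-- The slope at the inner sphere of the harmonic function on the annulus `ρ < |y| < R` in
dimension `n + 2` which is `0` on the inner and `1` on the outer sphere. -/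
def barrierSlope (n : ℕ) (ρ R : ℝ) : ℝ := n / (ρ * (1 - (ρ / R) ^ n))

/-- The radial barrier, `0` on the ball of radius `ρ`, harmonic outside of it and `1` on the sphere
of radius `R`, in dimension `n + 2`. -/
def barrier (x : Euc N) (n : ℕ) (ρ R : ℝ) (y : Euc N) : ℝ :=
  (1 - (ρ / R) ^ n)⁻¹ - (1 - (ρ / R) ^ n)⁻¹ * ρ ^ n * radialPow x ρ n y

section Barrier

variable {x y : Euc N} {n : ℕ} {ρ R : ℝ}

theorem one_sub_div_pow_pos (hn : n ≠ 0) (hρ : 0 < ρ) (hR : ρ < R) : 0 < 1 - (ρ / R) ^ n := by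
  have : (ρ / R) ^ n < 1 :=
    pow_lt_one₀ (div_nonneg hρ.le (hρ.trans hR).le) ((div_lt_one (hρ.trans hR)).2 hR) hn
  linarith

theorem barrier_of_le (hρ : 0 < ρ) (hy : ‖y - x‖ ≤ ρ) : barrier x n ρ R y = 0 := by
  rw [barrier, radialPow_of_le n hy, mul_assoc, ← mul_pow, mul_inv_cancel₀ hρ.ne', one_pow,
    mul_one, sub_self]

theorem barrier_of_lt (hy : ρ < ‖y - x‖) :
    barrier x n ρ R y = (1 - (ρ / R) ^ n)⁻¹ * (1 - (ρ / ‖y - x‖) ^ n) := by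
  rw [barrier, radialPow_of_lt n hy, div_eq_mul_inv ρ ‖y - x‖, mul_pow]
  ring

theorem barrier_pos (hn : n ≠ 0) (hρ : 0 < ρ) (hR : ρ < R) (hy : ρ < ‖y - x‖) :
    0 < barrier x n ρ R y := by
  rw [barrier_of_lt hy]
  exact mul_pos (inv_pos.2 (one_sub_div_pow_pos hn hρ hR)) (one_sub_div_pow_pos hn hρ hy)

theorem barrier_nonneg (hn : n ≠ 0) (hρ : 0 < ρ) (hR : ρ < R) : 0 ≤ barrier x n ρ R y := by
  rcases le_or_gt ‖y - x‖ ρ with h | h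
  · exact (barrier_of_le hρ h).ge
  · exact (barrier_pos hn hρ hR h).le

theorem one_le_barrier (hn : n ≠ 0) (hρ : 0 < ρ) (hR : ρ < R) (hy : R ≤ ‖y - x‖) :
    1 ≤ barrier x n ρ R y := by
  have h0 := one_sub_div_pow_pos hn hρ hR
  have hR0 : 0 < R := hρ.trans hR
  rw [barrier_of_lt (hR.trans_le hy), inv_mul_eq_div, one_le_div h0]
  gcongr

theorem isWeakGradient_barrier [NeZero N] (x : Euc N) (n : ℕ) (hρ : 0 < ρ) (R : ℝ) :
    IsWeakGradient (barrier x n ρ R)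
      (fun y => -((1 - (ρ / R) ^ n)⁻¹ * ρ ^ n) • radialPowGrad x ρ n y) := by
  have h := (isWeakGradient_const (N := N) (1 - (ρ / R) ^ n)⁻¹).sub
    ((isWeakGradient_radialPow x hρ n).const_mul ((1 - (ρ / R) ^ n)⁻¹ * ρ ^ n))
  simp only [Pi.zero_apply, zero_sub, ← neg_smul] at h
  exact h

end Barrier

/-! ### Comparison of a minimizer with the barrier -/

theorem memLp_of_bounded_support {F : Type*} [NormedAddCommGroup F] {f : Euc N → F}
    (hf : AEStronglyMeasurable f volume) {K : Set (Euc N)} (hK : IsCompact K) {C : ℝ}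
    (hC : ∀ y, ‖f y‖ ≤ C) (h0 : ∀ y, y ∉ K → f y = 0) (p : ENNReal) : MemLp f p volume := by
  refine (memLp_indicator_const p hK.measurableSet C (Or.inr hK.measure_lt_top.ne)).mono hf
    (Eventually.of_forall fun y => ?_)
  by_cases hy : y ∈ K
  · rw [indicator_of_mem hy]
    exact (hC y).trans (le_abs_self _)
  · simp [h0 y hy]

/-- A minimizer vanishes on a ball where the weight exceeds the threshold given by the barrier. -/
theorem IsMinimizer.ae_nonpos_of_lt_weight {n : ℕ} (hn : n ≠ 0) {S : Set (Euc (n + 2))} {h : ℝ}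
    {Ω : Set (Euc (n + 2))} (hΩ : IsOpen Ω) {u : Euc (n + 2) → ℝ} (hu : IsMinimizer S h Ω u)
    {x : Euc (n + 2)} {ρ R A : ℝ} (hρ : 0 < ρ) (hR : ρ < R) (hS : ∀ y ∈ S, R ≤ ‖y - x‖)
    (hA : barrierSlope n ρ R ^ 2 + 2 * (n + 2) * (barrierSlope n ρ R / ρ) < A)
    (hw : ∀ y, ‖y - x‖ ≤ ρ → A ≤ weight h Ω y) :
    ∀ᵐ y, ‖y - x‖ ≤ ρ → u y ≤ 0 := by
  have hR0 : 0 < R := hρ.trans hR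
  set b := barrierSlope n ρ R with hb
  set a := (1 - (ρ / R) ^ n)⁻¹ with ha
  have ha0 : 0 < a := inv_pos.2 (one_sub_div_pow_pos hn hρ hR)
  have hba : b = a * n / ρ := by
    rw [hb, ha, barrierSlope]
    have := (one_sub_div_pow_pos hn hρ hR).ne'
    field_simp
  set ε := A - (b ^ 2 + 2 * (n + 2) * (b / ρ)) with hε
  have hε0 : 0 < ε := sub_pos.2 hA
  set c := a * n * ρ ^ n with hc
  have hc0 : 0 ≤ c := by positivity
  set κ := radialPow x ρ (n + 2) with hκ
  have hκ0 : ∀ y, 0 ≤ κ y := radialPow_nonneg hρ _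
  -- Inside the ball the continued field `c κ (y - x)` is `(b/ρ)(y - x)`, which matches the slope
  -- `b` at radius `ρ`.
  have hq : c * ρ⁻¹ ^ (n + 2) = b / ρ := by
    rw [hc, hba, inv_pow, pow_add]
    field_simp
  have hu1 := hu.ae_le_one (by omega) hΩ
  obtain ⟨hH1, hLt, h1S, -⟩ := hu.1
  set G := weakGrad u with hG
  set w := barrier x n ρ R with hwdef
  set W : Euc (n + 2) → Euc (n + 2) :=
    fun y => -(a * ρ ^ n) • radialPowGrad x ρ n y with hW
  have hW_in : ∀ y, ‖y - x‖ ≤ ρ → W y = 0 := fun y hy => by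
    simp [hW, radialPowGrad, not_lt.2 hy]
  have hW_out : ∀ y, ρ < ‖y - x‖ → W y = (c * κ y) • (y - x) := fun y hy => by
    simp only [hW, radialPowGrad, if_pos hy, hκ, radialPow_of_lt _ hy, hc, smul_smul]
    congr 1
    ring
  have hwW : IsWeakGradient w W := isWeakGradient_barrier x n hρ R
  have hdiff := hH1.isWeakGradient.sub hwW
  have hpos := hdiff.posPart
  set Bl := Metric.closedBall x R with hBl
  have hBlc : IsCompact Bl := isCompact_closedBall _ _
  have hout : ∀ y, y ∉ Bl → R < ‖y - x‖ := fun y hy => by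
    rwa [hBl, mem_closedBall_iff_norm, not_le] at hy
  set P : Set (Euc (n + 2)) := {y | 0 < u y - w y} with hP
  have hPn : ∀ y, u y ≤ w y → y ∉ P := fun y hy h => (sub_pos.1 h).not_ge hy
  set f : Euc (n + 2) → ℝ := Bl.indicator fun y => max (u y - w y) 0 with hf
  set F : Euc (n + 2) → Euc (n + 2) := Bl.indicator (P.indicator fun y => G y - W y) with hF
  -- Cutting off outside `B_R` changes nothing a.e., because `u ≤ 1 ≤ w` there.
  have hfF : IsWeakGradient f F := by
    refine hpos.congr ?_ ?_
    · filter_upwards [hu1] with y hy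
      by_cases hyB : y ∈ Bl
      · simp only [hf, indicator_of_mem hyB]
      · simp only [hf, indicator_of_notMem hyB]
        have := one_le_barrier hn hρ hR (hout y hyB).le
        exact max_eq_right (by linarith)
    · filter_upwards [hu1] with y hy
      by_cases hyB : y ∈ Bl
      · simp only [hF, indicator_of_mem hyB]
        rfl
      · simp only [hF, indicator_of_notMem hyB]
        have := one_le_barrier hn hρ hR (hout y hyB).le
        exact indicator_of_notMem (hPn y (by linarith)) _
  have hf0 : ∀ y, y ∉ Bl → f y = 0 := fun y hy => indicator_of_notMem hy _
  have hF0 : ∀ y, y ∉ Bl → F y = 0 := fun y hy => indicator_of_notMem hy _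
  have hfm : AEStronglyMeasurable f volume := hfF.1.aestronglyMeasurable
  have hFm : AEStronglyMeasurable F volume := hfF.2.1.aestronglyMeasurable
  have hfu : ∀ y, ‖f y‖ ≤ ‖u y‖ := fun y => by
    refine (norm_indicator_le_norm_self _ _).trans ?_
    rw [Real.norm_of_nonneg (le_max_right _ _), Real.norm_eq_abs]
    have : 0 ≤ w y := barrier_nonneg hn hρ hR
    exact max_le (by linarith [le_abs_self (u y)]) (abs_nonneg _)
  have hf2 : MemLp f 2 volume := hH1.1.mono hfm (Eventually.of_forall hfu)
  have hft : MemLp f ⊤ volume := hLt.mono hfm (Eventually.of_forall hfu)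
  have hWm : AEStronglyMeasurable W volume := hwW.2.1.aestronglyMeasurable
  have hWb : MemLp (Bl.indicator W) 2 volume := by
    refine memLp_of_bounded_support (hWm.indicator hBlc.measurableSet) hBlc
      (C := a * ρ ^ n * (n * ρ⁻¹ ^ (n + 1))) (fun y => ?_) (fun y hy => indicator_of_notMem hy _) 2
    refine (norm_indicator_le_norm_self _ _).trans ?_
    rw [hW, norm_smul, norm_neg, Real.norm_of_nonneg (by positivity)]
    exact mul_le_mul_of_nonneg_left (norm_radialPowGrad_le hρ n y) (by positivity)
  have hF2 : MemLp F 2 volume := by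
    refine (hH1.memLp_weakGrad.sub hWb).mono hFm (Eventually.of_forall fun y => ?_)
    by_cases hyB : y ∈ Bl
    · simp only [hF, indicator_of_mem hyB, Pi.sub_apply]
      exact norm_indicator_le_norm_self (fun y => G y - W y) y
    · rw [hF0 y hyB, norm_zero]
      exact norm_nonneg _
  have hfS : ∀ᵐ y, y ∈ S → f y = 0 ∧ F y = 0 := by
    filter_upwards [h1S] with y hy hyS
    have h1 : 1 ≤ w y := one_le_barrier hn hρ hR (hS y hyS)
    have h2 := hy hyS
    by_cases hyB : y ∈ Bl
    · simp only [hf, hF, indicator_of_mem hyB]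
      exact ⟨max_eq_right (by linarith),
        indicator_of_notMem (hPn y (by linarith)) _⟩
    · exact ⟨hf0 y hyB, hF0 y hyB⟩
  set d : Euc (n + 2) → ℝ :=
    (Metric.closedBall x ρ).indicator (fun _ => ((n + 2 : ℕ) : ℝ) * ρ⁻¹ ^ (n + 2)) with hd
  set T : Set (Euc (n + 2)) := Metric.closedBall x ρ ∩ {y | 0 < u y} with hT
  have hTm : NullMeasurableSet T volume :=
    Metric.isClosed_closedBall.measurableSet.nullMeasurableSet.inter
      (nullMeasurableSet_pos hH1.1.aestronglyMeasurable)
  have hTfin : volume T ≠ ⊤ :=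
    ((measure_mono inter_subset_left).trans_lt measure_closedBall_lt_top).ne
  have hdiv := hfF.integral_radialPow_mul_inner x hρ hf0 hF0
  have hκm : Continuous κ := (exists_lipschitzWith_radialPow x hρ (n + 2)).choose_spec.continuous
  have i1 : Integrable (fun y => κ y * inner ℝ (F y) (y - x)) volume := by
    have hV : MemLp (Bl.indicator fun y => κ y • (y - x)) 2 volume := by
      refine memLp_of_bounded_support (Continuous.aestronglyMeasurable (by fun_prop) |>.indicator
        hBlc.measurableSet) hBlc (C := ρ⁻¹ ^ (n + 2) * R) (fun y => ?_)
        (fun y hy => indicator_of_notMem hy _) 2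
      by_cases hyB : y ∈ Bl
      · rw [indicator_of_mem hyB, norm_smul, Real.norm_of_nonneg (hκ0 y)]
        rw [hBl, mem_closedBall_iff_norm] at hyB
        exact mul_le_mul (radialPow_le hρ _ y) hyB (norm_nonneg _) (by positivity)
      · rw [indicator_of_notMem hyB, norm_zero]
        positivity
    have hFV : Integrable (fun y => inner ℝ (F y) (Bl.indicator (fun y => κ y • (y - x)) y))
        volume :=
      (MemLp.integrable_mul hF2.norm hV.norm).mono' (hFm.inner hV.1)
        (Eventually.of_forall fun y => norm_inner_le_norm _ _)
    refine hFV.congr (Eventually.of_forall fun y => ?_)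
    by_cases hyB : y ∈ Bl
    · simp only [indicator_of_mem hyB, real_inner_smul_right]
    · simp only [hF0 y hyB, inner_zero_left, mul_zero]
  have i2 : Integrable (fun y => d y * f y) volume := by
    have hfi : Integrable f volume := by
      rw [← integrableOn_iff_integrable_of_support_subset (s := Bl)]
      · exact hfF.1.integrableOn_isCompact hBlc
      · intro y hy
        by_contra h'
        exact hy (hf0 y h')
    refine hfi.bdd_mul (c := ((n + 2 : ℕ) : ℝ) * ρ⁻¹ ^ (n + 2))
      ((measurable_const.indicator
        Metric.isClosed_closedBall.measurableSet).aestronglyMeasurable)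
      (Eventually.of_forall fun y => ?_)
    refine (norm_indicator_le_norm_self _ _).trans ?_
    rw [Real.norm_of_nonneg (by positivity)]
  have i3 : Integrable (T.indicator fun _ => ε) volume :=
    (integrableOn_const hTfin).integrable_indicator₀ hTm
  -- The first two terms cancel after integration by the divergence identity, so `∫ B = -ε |T|`,
  -- while pointwise `B` bounds the change of energy.
  set B : Euc (n + 2) → ℝ := fun y => (-(2 * c)) * (κ y * inner ℝ (F y) (y - x)) +
    (-(2 * c)) * (d y * f y) - T.indicator (fun _ => ε) y with hB
  have iB : Integrable B volume := ((i1.const_mul _).add (i2.const_mul _)).sub i3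
  have hBint : ∫ y, B y = -(ε * volume.real T) := by
    have e1 : ∫ y, B y = (-(2 * c)) * (∫ y, κ y * inner ℝ (F y) (y - x)) +
        (-(2 * c)) * (∫ y, d y * f y) - ∫ y, T.indicator (fun _ => ε) y := by
      rw [← integral_const_mul, ← integral_const_mul,
        ← integral_add (i1.const_mul _) (i2.const_mul _)]
      exact integral_sub ((i1.const_mul _).add (i2.const_mul _)) i3
    rw [e1, hdiv, integral_indicator₀ hTm, setIntegral_const, smul_eq_mul]
    ring
  have hBS : ∀ᵐ y, y ∈ S → B y = 0 := by
    filter_upwards [hfS] with y hy hyS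
    obtain ⟨h1, h2⟩ := hy hyS
    have hyT : y ∉ T := by
      rintro ⟨hyρ, -⟩
      rw [mem_closedBall_iff_norm] at hyρ
      linarith [hS y hyS]
    simp [hB, h1, h2, indicator_of_notMem hyT]
  have hle : ∀ᵐ y, energyDensity h Ω (fun y => u y - f y) (fun y => G y - F y) y ≤
      energyDensity h Ω u G y + B y := by
    filter_upwards [hu1] with y hy1
    rcases le_or_gt (u y) (w y) with huw | huw
    · have hfy : f y = 0 := by
        by_cases hyB : y ∈ Bl
        · simp only [hf, indicator_of_mem hyB]
          exact max_eq_right (by linarith)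
        · exact hf0 y hyB
      have hFy : F y = 0 := by
        by_cases hyB : y ∈ Bl
        · simp only [hF, indicator_of_mem hyB]
          exact indicator_of_notMem (hPn y (by linarith)) _
        · exact hF0 y hyB
      have hyT : y ∉ T := by
        rintro ⟨hyρ, hyu⟩
        rw [mem_closedBall_iff_norm] at hyρ
        have : w y = 0 := barrier_of_le hρ hyρ
        have : 0 < u y := hyu
        linarith
      have hBy : B y = 0 := by simp [hB, hfy, hFy, indicator_of_notMem hyT]
      rw [hBy, add_zero]
      apply le_of_eq
      simp only [energyDensity, hFy, sub_zero]
      simp [indicator, hfy]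
    · have hyB : y ∈ Bl := by
        by_contra hyB
        have : 1 ≤ w y := one_le_barrier hn hρ hR (hout y hyB).le
        linarith
      have hw0 : 0 ≤ w y := barrier_nonneg hn hρ hR
      have hup : 0 < u y := hw0.trans_lt huw
      have hfy : f y = u y - w y := by
        simp only [hf, indicator_of_mem hyB]
        exact max_eq_left (by linarith)
      have hFy : F y = G y - W y := by
        simp only [hF, indicator_of_mem hyB]
        exact indicator_of_mem (show y ∈ P from sub_pos.2 huw) _
      rw [energyDensity_of_pos hup]
      rcases le_or_gt ‖y - x‖ ρ with hyρ | hyρ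
      · have hwy : w y = 0 := barrier_of_le hρ hyρ
        rw [hwy, sub_zero] at hfy
        rw [hW_in y hyρ, sub_zero] at hFy
        have hyT : y ∈ T := ⟨mem_closedBall_iff_norm.2 hyρ, hup⟩
        have hdy : d y = ((n + 2 : ℕ) : ℝ) * ρ⁻¹ ^ (n + 2) :=
          indicator_of_mem (mem_closedBall_iff_norm.2 hyρ) _
        have hκy : κ y = ρ⁻¹ ^ (n + 2) := radialPow_of_le _ hyρ
        have hBy : B y = -2 * (b / ρ) * inner ℝ (G y) (y - x)
            - 2 * (n + 2) * (b / ρ) * u y - ε := by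
          simp only [hB, hFy, hfy, indicator_of_mem hyT, hdy, hκy, ← hq]
          push_cast
          ring
        rw [energyDensity_of_nonpos (by simp [hfy]), hFy, hBy]
        -- On `B_ρ` the competitor is zero, so `|∇u|²` and the weight are saved. Young's inequality
        -- pays for the linear field and `u ≤ 1` for its divergence; `ε` is what remains of `A`.
        have hwt := hw y hyρ
        have hb0 : 0 ≤ b / ρ := by rw [← hq]; positivity
        have hin : inner ℝ (G y) (y - x) ≤ ‖G y‖ * ρ :=
          (real_inner_le_norm _ _).trans (mul_le_mul_of_nonneg_left hyρ (norm_nonneg _))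
        have h1 : b / ρ * inner ℝ (G y) (y - x) ≤ b * ‖G y‖ := by
          refine (mul_le_mul_of_nonneg_left hin hb0).trans (le_of_eq ?_)
          field_simp
        have h2 : (n + 2) * (b / ρ) * u y ≤ (n + 2) * (b / ρ) :=
          mul_le_of_le_one_right (by positivity) hy1
        simp only [sub_self, norm_zero]
        have h3 : 2 * (b * ‖G y‖) ≤ ‖G y‖ ^ 2 + b ^ 2 := by nlinarith [sq_nonneg (‖G y‖ - b)]
        linarith
      · have hwy : 0 < w y := barrier_pos hn hρ hR hyρ
        have hyρ' : y ∉ Metric.closedBall x ρ := by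
          rw [mem_closedBall_iff_norm, not_le]
          exact hyρ
        have hyT : y ∉ T := fun h => hyρ' h.1
        have hdy : d y = 0 := indicator_of_notMem hyρ' _
        have hBy : B y = -2 * inner ℝ (G y - W y) (W y) := by
          simp only [hB, hFy, indicator_of_notMem hyT, hdy]
          conv_rhs => rw [hW_out y hyρ, real_inner_smul_right]
          rw [← hW_out y hyρ]
          ring
        have hGW : G y - F y = W y := by rw [hFy, sub_sub_cancel]
        rw [energyDensity_of_pos (by simp only [hfy, sub_sub_cancel]; exact hwy), hGW, hBy,
          inner_sub_left, real_inner_self_eq_norm_sq]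
        -- `|W|² - |G|² = -2 (G - W) · W - |G - W|²`, and the last term is dropped.
        have h1 := norm_sub_sq_real (G y) (W y)
        linarith [sq_nonneg ‖G y - W y‖]
  have hfin := hu.integral_nonneg hΩ hfF hf2 hft hF2 (hfS.mono fun y hy hyS => (hy hyS).1)
    ⟨Bl, hBlc, Eventually.of_forall hf0⟩ iB hBS hle
  rw [hBint] at hfin
  have hT0 : volume.real T = 0 := by
    have := measureReal_nonneg (μ := volume) (s := T)
    nlinarith
  have hT0' : volume T = 0 := (measureReal_eq_zero_iff hTfin).1 hT0
  filter_upwards [measure_eq_zero_iff_ae_notMem.1 hT0'] with y hy hyρ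
  by_contra hup
  exact hy ⟨mem_closedBall_iff_norm.2 hyρ, not_le.1 hup⟩

/-! ### The threshold for the barrier slope -/

theorem div_two_rpow_pow {R : ℝ} (hR : 0 < R) {n : ℕ} (hn : n ≠ 0) :
    (R / (2 : ℝ) ^ (1 / (n : ℝ)) / R) ^ n = 1 / 2 := by
  rw [div_right_comm, div_self hR.ne', div_pow, one_pow, one_div (n : ℝ),
    Real.rpow_inv_natCast_pow (by norm_num) hn]

theorem div_two_rpow_lt {R : ℝ} (hR : 0 < R) {n : ℕ} (hn : n ≠ 0) :
    R / (2 : ℝ) ^ (1 / (n : ℝ)) < R := by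
  refine div_lt_self hR (Real.one_lt_rpow (by norm_num) ?_)
  positivity

/-- With `k = n / r₀`, the bound `(ρ/R)^n ≤ 1/2` gives slope `g < 2k`, and `n + 2 ≤ 3n` bounds the
second term by `6kg`. The sum is below `4k² + 12k² = (4k)² ≤ 1 + M`. -/
theorem barrierSlope_threshold {R r₀ M ρ : ℝ} (hR : 0 < R) {n : ℕ} (hn : n ≠ 0)
    (hr₀ : r₀ ∈ Ioo 0 (R / (2 : ℝ) ^ (1 / (n : ℝ)))) (hM : 4 * (n : ℝ) / r₀ ≤ √(1 + M))
    (hρ : ρ ∈ Icc r₀ (R / (2 : ℝ) ^ (1 / (n : ℝ)))) :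
    barrierSlope n ρ R ^ 2 + 2 * (n + 2) * (barrierSlope n ρ R / ρ) < 1 + M := by
  obtain ⟨hr0, hr1⟩ := hr₀
  obtain ⟨hρ0, hρ1⟩ := hρ
  have hn1 : (1 : ℝ) ≤ n := by exact_mod_cast Nat.one_le_iff_ne_zero.2 hn
  have hρpos : 0 < ρ := hr0.trans_le hρ0
  have hhalf := div_two_rpow_pow hR hn
  have ht : 1 / 2 ≤ 1 - (ρ / R) ^ n := by
    have : (ρ / R) ^ n ≤ 1 / 2 := by
      rw [← hhalf]
      gcongr
    linarith
  -- Strictness comes from `ρ > r₀`, or at `ρ = r₀` from `(r₀/R)^n < 1/2`.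
  have hmul : r₀ / 2 < ρ * (1 - (ρ / R) ^ n) := by
    rcases hρ0.eq_or_lt with rfl | hlt
    · have : (r₀ / R) ^ n < 1 / 2 := by
        rw [← hhalf]
        gcongr
      nlinarith
    · nlinarith
  set g := barrierSlope n ρ R with hg
  set k := (n : ℝ) / r₀ with hk
  have hk0 : 0 < k := by positivity
  have hg0 : 0 ≤ g := by
    rw [hg, barrierSlope]
    exact div_nonneg (by positivity) (by linarith)
  have hgk : g < 2 * k := by
    rw [hg, barrierSlope, div_lt_iff₀ (by linarith)]
    have h1 := mul_lt_mul_of_pos_left hmul (by positivity : 0 < 2 * k)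
    have h2 : 2 * k * (r₀ / 2) = n := by
      rw [hk]
      field_simp
    linarith
  have h1 : g / ρ ≤ g / r₀ := by gcongr
  have h2 : 2 * ((n : ℝ) + 2) * (g / ρ) ≤ 6 * k * g := by
    have h3 : 2 * ((n : ℝ) + 2) * (g / ρ) ≤ 6 * n * (g / r₀) := by
      have h4 : 0 ≤ g / ρ := by positivity
      have h5 : 0 ≤ g / r₀ := by positivity
      nlinarith
    refine h3.trans (le_of_eq ?_)
    rw [hk]
    ring
  have h3 : (4 * k) ^ 2 ≤ 1 + M := by
    rw [mul_div_assoc, ← hk] at hM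
    exact (Real.le_sqrt' (by positivity)).1 hM
  nlinarith

/-- The strict inequality is an open condition on `(0, R)` that holds on a compact interval, hence
on a uniform neighbourhood. Both sides of `r` are needed, as `M` may be negative. -/
theorem exists_barrierSlope_threshold {R r₀ M : ℝ} (hR : 0 < R) {n : ℕ} (hn : n ≠ 0)
    (hr₀ : r₀ ∈ Ioo 0 (R / (2 : ℝ) ^ (1 / (n : ℝ)))) (hM : 4 * (n : ℝ) / r₀ ≤ √(1 + M)) :
    ∃ δ > 0, ∀ r ∈ Icc r₀ (R / (2 : ℝ) ^ (1 / (n : ℝ))), ∀ ρ, |ρ - r| < δ →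
      0 < ρ ∧ ρ < R ∧
        barrierSlope n ρ R ^ 2 + 2 * (n + 2) * (barrierSlope n ρ R / ρ) < 1 + M := by
  have hcont : ContinuousOn
      (fun ρ => barrierSlope n ρ R ^ 2 + 2 * ((n : ℝ) + 2) * (barrierSlope n ρ R / ρ))
      (Ioo 0 R) := by
    have h1 : ContinuousOn (fun ρ => barrierSlope n ρ R) (Ioo 0 R) := by
      refine ContinuousOn.div continuousOn_const (by fun_prop) fun ρ hρ => ?_
      exact (mul_pos hρ.1 (one_sub_div_pow_pos hn hρ.1 hρ.2)).ne'
    exact (h1.pow 2).add (continuousOn_const.mul (h1.div continuousOn_id fun ρ hρ => hρ.1.ne'))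
  have hopen := hcont.isOpen_inter_preimage isOpen_Ioo (isOpen_Iio (a := 1 + M))
  obtain ⟨δ, hδ, hsub⟩ := (isCompact_Icc (a := r₀)
    (b := R / (2 : ℝ) ^ (1 / (n : ℝ)))).exists_thickening_subset_open hopen fun ρ hρ =>
      ⟨⟨hr₀.1.trans_le hρ.1, hρ.2.trans_lt (div_two_rpow_lt hR hn)⟩,
        barrierSlope_threshold hR hn hr₀ hM hρ⟩
  refine ⟨δ, hδ, fun r hr ρ hρ => ?_⟩
  have h := hsub (Metric.mem_thickening_iff.2 ⟨r, hr, by rwa [Real.dist_eq]⟩)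
  exact ⟨h.1.1, h.1.2, h.2⟩

/-! ### The positivity set of the precise representative -/

theorem posSet_nonempty {S : Set (Euc N)} (hS : IsSource S) {u : Euc N → ℝ}
    (hu : ∀ᵐ y, y ∈ S → u y = 1) : (posSet u).Nonempty := by
  obtain ⟨U, hU, ⟨y, hy⟩, -, -, rfl⟩ := hS
  refine ⟨y, 1, one_pos, tendsto_const_nhds.congr' ?_⟩
  obtain ⟨η, hη, hball⟩ := Metric.isOpen_iff.1 hU y hy
  filter_upwards [Ioo_mem_nhdsGT hη] with δ hδ
  have hsub : Metric.closedBall y δ ⊆ closure U :=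
    ((Metric.closedBall_subset_ball hδ.2).trans hball).trans subset_closure
  have hae : u =ᵐ[volume.restrict (Metric.closedBall y δ)] fun _ => (1 : ℝ) :=
    (ae_restrict_iff' Metric.isClosed_closedBall.measurableSet).2
      (hu.mono fun z hz hzb => hz (hsub hzb))
  rw [average_congr hae, setAverage_const
    (Metric.measure_closedBall_pos volume y hδ.1).ne' measure_closedBall_lt_top.ne]

/-- Small balls around `y` stay in the ball of radius `ρ`, so their averages, and any limit of
these, are nonpositive. -/
theorem notMem_posSet {u : Euc N → ℝ} {x y : Euc N} {ρ : ℝ}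
    (hu : ∀ᵐ z, ‖z - x‖ ≤ ρ → u z ≤ 0) (hy : dist x y < ρ) : y ∉ posSet u := by
  rintro ⟨c, hc, hlim⟩
  refine hc.not_ge (le_of_tendsto hlim ?_)
  filter_upwards [Ioo_mem_nhdsGT (sub_pos.2 hy)] with δ hδ
  rw [setAverage_eq, smul_eq_mul]
  refine mul_nonpos_of_nonneg_of_nonpos (inv_nonneg.2 measureReal_nonneg) ?_
  refine setIntegral_nonpos_of_ae_restrict ?_
  refine (ae_restrict_iff' Metric.isClosed_closedBall.measurableSet).2
    (hu.mono fun z hz hzb => hz ?_)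
  rw [Metric.mem_closedBall] at hzb
  rw [← dist_eq_norm]
  have := dist_triangle z y x
  rw [dist_comm y x] at this
  linarith [hδ.2]

end BernoulliFlow

end

/-! ### Conclusion -/

theorem lemma4p5 (N : ℕ) (hN : 3 ≤ N) (R r₀ M : ℝ) (hR : 0 < R)
    (hr₀ : r₀ ∈ Set.Ioo 0 (R / (2 : ℝ) ^ (1 / ((N : ℝ) - 2))))
    (hM : 4 * ((N : ℝ) - 2) / r₀ ≤ Real.sqrt (1 + M)) :
    ∃ h₀ : ℝ, 0 < h₀ ∧
      ∀ h ∈ Set.Ioo 0 h₀, ∀ r ∈ Set.Ioo r₀ (R / (2 : ℝ) ^ (1 / ((N : ℝ) - 2))),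
      ∀ S : Set (BernoulliFlow.Euc N), BernoulliFlow.IsSource S →
      ∀ Ω ∈ BernoulliFlow.classD S, IsOpen Ω →
      ∀ x : BernoulliFlow.Euc N, x ∉ closure Ω →
        r ≤ Metric.infDist x Ω → R ≤ Metric.infDist x S →
      ∀ u : BernoulliFlow.Euc N → ℝ, BernoulliFlow.IsMinimizer S h Ω u →
        r - M * h ≤
          Metric.infDist x (BernoulliFlow.posSet u ∪ BernoulliFlow.innerSet Ω h) := by
  obtain ⟨n, rfl⟩ : ∃ n, N = n + 2 := ⟨N - 2, by omega⟩
  have hn : n ≠ 0 := by omega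
  have hcast : ((n + 2 : ℕ) : ℝ) - 2 = n := by push_cast; ring
  rw [hcast] at hr₀ hM ⊢
  have hM1 : 0 < 1 + M := by
    refine Real.sqrt_pos.1 (lt_of_lt_of_le ?_ hM)
    have := hr₀.1
    positivity
  obtain ⟨δ, hδ, hthr⟩ := BernoulliFlow.exists_barrierSlope_threshold hR hn hr₀ hM
  -- This choice gives `|M| h < δ`; the `+ 1` covers `M = 0`.
  refine ⟨δ / (|M| + 1), by positivity, ?_⟩
  rintro h ⟨hh0, hh1⟩ r ⟨hr1, hr2⟩ S hS Ω - hΩ x hx hxΩ hxS u hu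
  have hclose : |r - M * h - r| < δ := by
    rw [sub_sub_cancel_left, abs_neg, abs_mul, abs_of_pos hh0]
    rw [lt_div_iff₀ (by positivity)] at hh1
    nlinarith [abs_nonneg M]
  obtain ⟨hρ0, hρR, hA⟩ := hthr r ⟨hr1.le, hr2.le⟩ _ hclose
  have hS' : ∀ y ∈ S, R ≤ ‖y - x‖ := fun y hy => by
    rw [← dist_eq_norm, dist_comm]
    exact hxS.trans (Metric.infDist_le_dist_of_mem hy)
  have hw : ∀ y, ‖y - x‖ ≤ r - M * h → 1 + M ≤ BernoulliFlow.weight h Ω y := by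
    intro y hy
    have h1 := BernoulliFlow.sub_dist_le_sdist hx hxΩ y
    rw [dist_eq_norm] at h1
    refine le_trans ?_ (le_max_left _ _)
    have h2 : M * h ≤ BernoulliFlow.sdist Ω y := by linarith
    rw [one_div, inv_mul_eq_div]
    linarith [(le_div_iff₀ hh0).2 h2]
  have hae := hu.ae_nonpos_of_lt_weight hn hΩ hρ0 hρR hS' hA hw
  -- Nonemptiness matters: `Metric.infDist` to the empty set is `0` by convention.
  rw [Metric.le_infDist ((BernoulliFlow.posSet_nonempty hS hu.1.2.2.1).mono subset_union_left)]
  rintro y (hy | ⟨hyΩ, hyh⟩)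
  · by_contra hlt
    exact BernoulliFlow.notMem_posSet hae (not_le.1 hlt) hy
  -- Here `|y - x| > r + h`, and `r + h > r - M h` because `1 + M > 0`.
  · have h1 := BernoulliFlow.infDist_frontier_le hx hxΩ hyΩ
    rw [dist_comm]
    nlinarith
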